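/- Let $n\ge 2$, let $G_0$ be the self-adjoint realization of $-\Delta$ on $L^2(\mathbb R^n)$, let $\langle x\rangle=(1+|x|^2)^{1/2}$, and let $\varphi\in C_0^\infty((0,+\infty))$. For $t\in\mathbb R$ and $0<h\le 1$ the operator $e^{it\sqrt{G_0}}\varphi(h\sqrt{G_0})$ is defined on $L^2(\mathbb R^n)$ by the functional calculus of $G_0$, and on $L^1(\mathbb R^n)$ as the unique bounded operator $L^1\to L^\infty$ which coincides with it on $L^1\cap L^2$; this extension exists for every $t\in\mathbb R$ and $0<h\le 1$. For every $0\le s\le (n-1)/2$ and every $\epsilon>0$ there is a constant $C>0$ such that for all $0<h\le 1$ the following estimates hold: $$\left\|\langle x\rangle^{-s}e^{it\sqrt{G_0}}\varphi(h\sqrt{G_0})\langle x\rangle^{-s}\right\|_{L^2\to L^2}\le C\langle t\rangle^{-s},\qquad \forall t\in\mathbb R,$$ $$\left\|e^{it\sqrt{G_0}}\varphi(h\sqrt{G_0})\right\|_{L^1\to L^\infty}\le Ch^{-(n+1)/2}|t|^{-(n-1)/2},\qquad \forall t\neq 0,$$ $$\left\|e^{it\sqrt{G_0}}\varphi(h\sqrt{G_0})\langle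 x\rangle^{-1/2-s-\epsilon}\right\|_{L^2\to L^\infty}\le Ch^{-(n+1)/2}|t|^{-s},\qquad \forall t\neq 0,$$ $$\int_{-\infty}^\infty|t|^{2s}\left\|\langle x\rangle^{-1/2-s-\epsilon}e^{it\sqrt{G_0}}\varphi(h\sqrt{G_0})f\right\|_{L^2}^2\,dt\le Ch^{-n}\|f\|_{L^1}^2,\qquad \forall f\in L^1(\mathbb R^n).$$ The constant $C$ is independent of $t$, $h$ and $f$. -/

import Mathlib

open MeasureTheory FourierTransform
open scoped ENNReal ContDiff

noncomputable section

namespace FreeWave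

/-- `ℝⁿ` with its Euclidean norm and Lebesgue measure. -/
abbrev Eucl (n : ℕ) : Type := EuclideanSpace ℝ (Fin n)

/-- The complex space `L^p(ℝⁿ)`. -/
abbrev LpR (n : ℕ) (p : ℝ≥0∞) : Type := Lp (α := Eucl n) ℂ p volume

/-- `⟨x⟩ = (1 + |x|²)^{1/2}`, on `ℝⁿ` and (for the time variable) on `ℝ`. -/
def bracket {V : Type*} [NormedAddCommGroup V] (x : V) : ℝ := Real.sqrt (1 + ‖x‖ ^ 2)

/-- The bounded operator of multiplication by an essentially bounded function `m` on
`L²(ℝⁿ)`. -/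
def mulOp {n : ℕ} (m : Eucl n → ℂ) (hm : MemLp m ∞ volume) : LpR n 2 →L[ℂ] LpR n 2 :=
  (ContinuousLinearMap.mul ℂ ℂ).holderL volume ∞ 2 2 (hm.toLp m)

/-- The bounded Fourier multiplier `𝓕⁻¹ m(ξ) 𝓕` on `L²(ℝⁿ)`. -/
def fourierMul {n : ℕ} (m : Eucl n → ℂ) (hm : MemLp m ∞ volume) : LpR n 2 →L[ℂ] LpR n 2 :=
  ((Lp.fourierTransformₗᵢ (Eucl n) ℂ).symm : LpR n 2 →L[ℂ] LpR n 2) ∘L mulOp m hm ∘L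
    ((Lp.fourierTransformₗᵢ (Eucl n) ℂ) : LpR n 2 →L[ℂ] LpR n 2)

theorem memLp_symbol (n : ℕ) {F : ℝ → ℂ} (hF : Measurable F) (hb : ∃ M, ∀ l, ‖F l‖ ≤ M) :
    MemLp (fun ξ : Eucl n => F ((2 * Real.pi * ‖ξ‖) ^ 2)) ∞ volume := by
  obtain ⟨M, hM⟩ := hb
  exact memLp_top_of_bound (hF.comp (by fun_prop)).aestronglyMeasurable M
    (Filter.Eventually.of_forall fun ξ => hM _)

/-- The functional calculus `F ↦ F(G₀)`, for bounded Borel functions `F`, of the self-adjoint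
realization `G₀` of `-Δ` on `L²(ℝⁿ)`. With the normalization
`𝓕 f(ξ) = ∫ e^{-2πi⟨x,ξ⟩} f(x) dx`, the Fourier transform turns `G₀` into multiplication by
`(2π|ξ|)²`. -/
def calcG₀ (n : ℕ) (F : ℝ → ℂ) (hF : Measurable F) (hb : ∃ M, ∀ l, ‖F l‖ ≤ M) :
    LpR n 2 →L[ℂ] LpR n 2 :=
  fourierMul (fun ξ : Eucl n => F ((2 * Real.pi * ‖ξ‖) ^ 2)) (memLp_symbol n hF hb)

section Resolvent

open TemperedDistribution Laplacian
open scoped SchwartzMap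

theorem fourierMul_toTemperedDistribution {n : ℕ} {g : Eucl n → ℂ} (hg : g.HasTemperateGrowth)
    (hm : MemLp g ∞ volume) (v : LpR n 2) :
    ((fourierMul g hm v : LpR n 2) : 𝓢'(Eucl n, ℂ)) =
      fourierMultiplierCLM ℂ g (v : 𝓢'(Eucl n, ℂ)) := by
  rw [fourierMultiplierCLM_apply, Lp.fourier_toTemperedDistribution_eq,
    ← Lp.toTemperedDistribution_smul_eq (p := ∞) (q := 2) (r := 2) hg hm,
    Lp.fourierInv_toTemperedDistribution_eq]
  rfl

/-- The operator `F(G₀)` with `F(l) = (1 + l)⁻¹` on `[0, ∞)` is the resolvent `(1 + G₀)⁻¹`: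
`u = F(G₀) v` solves `u - Δu = v` in the sense of distributions, for every `v ∈ L²`. -/
theorem calcG₀_resolvent (n : ℕ) (hF : Measurable fun l : ℝ => ((1 + |l| : ℝ) : ℂ)⁻¹)
    (hb : ∃ M, ∀ l : ℝ, ‖((1 + |l| : ℝ) : ℂ)⁻¹‖ ≤ M) (v : LpR n 2) :
    (calcG₀ n _ hF hb v : 𝓢'(Eucl n, ℂ)) - Δ (calcG₀ n _ hF hb v : 𝓢'(Eucl n, ℂ)) = v := by
  have e : (fun ξ : Eucl n => ((1 + |(2 * Real.pi * ‖ξ‖) ^ 2| : ℝ) : ℂ)⁻¹) =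
      fun ξ => (((1 + ‖(2 * Real.pi) • ξ‖ ^ 2) ^ (-1 : ℝ) : ℝ) : ℂ) := by
    ext ξ
    rw [Real.rpow_neg_one, norm_smul, abs_of_nonneg (sq_nonneg _), Complex.ofReal_inv,
      Real.norm_of_nonneg (by positivity)]
  have h1 : (fun ξ : Eucl n => (((1 + ‖ξ‖ ^ 2) ^ (-1 : ℝ) : ℝ) : ℂ)).HasTemperateGrowth := by
    fun_prop
  have h2 : (fun ξ : Eucl n => (2 * Real.pi) • ξ).HasTemperateGrowth := by
    exact ((2 * Real.pi) • ContinuousLinearMap.id ℝ (Eucl n)).hasTemperateGrowth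
  have hg : (fun ξ : Eucl n => ((1 + |(2 * Real.pi * ‖ξ‖) ^ 2| : ℝ) : ℂ)⁻¹).HasTemperateGrowth := by
    rw [e]; exact h1.comp h2
  have h3 : (fun x : Eucl n ↦ Complex.ofReal (‖x‖ ^ 2)).HasTemperateGrowth := by fun_prop
  have h4 : (((-(2 * Real.pi) ^ 2 : ℝ) : ℂ) • ((fun ξ : Eucl n =>
      ((1 + |(2 * Real.pi * ‖ξ‖) ^ 2| : ℝ) : ℂ)⁻¹) *
        fun x => Complex.ofReal (‖x‖ ^ 2))).HasTemperateGrowth :=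
    (Function.HasTemperateGrowth.const ((-(2 * Real.pi) ^ 2 : ℝ) : ℂ)).mul (hg.mul h3)
  unfold calcG₀
  rw [fourierMul_toTemperedDistribution hg, laplacian_eq_fourierMultiplierCLM,
    fourierMultiplierCLM_fourierMultiplierCLM_apply hg h3]
  rw [← Complex.coe_smul, fourierMultiplierCLM_apply, fourierMultiplierCLM_apply,
    ← FourierTransform.fourierInv_smul, ← _root_.smul_apply, ← smulLeftCLM_smul (hg.mul h3),
    ← FourierTransform.fourierInvCLM_apply (R := ℂ), ← FourierTransform.fourierInvCLM_apply (R := ℂ),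
    ← map_sub, ← _root_.sub_apply,
    ← smulLeftCLM_sub hg h4]
  have e1 : ((fun ξ : Eucl n => ((1 + |(2 * Real.pi * ‖ξ‖) ^ 2| : ℝ) : ℂ)⁻¹) -
      ((-(2 * Real.pi) ^ 2 : ℝ) : ℂ) • ((fun ξ : Eucl n =>
        ((1 + |(2 * Real.pi * ‖ξ‖) ^ 2| : ℝ) : ℂ)⁻¹) * fun x => Complex.ofReal (‖x‖ ^ 2))) =
      fun _ => 1 := by
    ext ξ
    have : ((1 + (2 * Real.pi * ‖ξ‖) ^ 2 : ℝ) : ℂ) ≠ 0 := by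
      exact_mod_cast (by positivity : (0 : ℝ) < 1 + (2 * Real.pi * ‖ξ‖) ^ 2).ne'
    simp only [Pi.sub_apply, Pi.smul_apply, Pi.mul_apply, smul_eq_mul,
      abs_of_nonneg (sq_nonneg (2 * Real.pi * ‖ξ‖))]
    push_cast at this ⊢
    linear_combination inv_mul_cancel₀ this
  rw [e1, smulLeftCLM_const, one_smul, FourierTransform.fourierInvCLM_apply,
    FourierTransform.fourierInv_fourier_eq]

end Resolvent

/-- The function `l ↦ e^{it√l} φ(h√l)`. -/
def waveFun (φ : ℝ → ℂ) (t h : ℝ) (l : ℝ) : ℂ :=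
  Complex.exp (Complex.I * (t * Real.sqrt l : ℝ)) * φ (h * Real.sqrt l)

theorem measurable_waveFun {φ : ℝ → ℂ} (hφ : Continuous φ) (t h : ℝ) :
    Measurable (waveFun φ t h) := by
  unfold waveFun
  exact Continuous.measurable (by fun_prop)

theorem bounded_waveFun {φ : ℝ → ℂ} (hφ : Continuous φ) (hc : HasCompactSupport φ) (t h : ℝ) :
    ∃ M, ∀ l, ‖waveFun φ t h l‖ ≤ M := by
  obtain ⟨M, hM⟩ := hφ.bounded_above_of_compact_support hc
  refine ⟨M, fun l => ?_⟩
  unfold waveFun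
  rw [norm_mul, mul_comm Complex.I, Complex.norm_exp_ofReal_mul_I, one_mul]
  exact hM _

/-- The operator `e^{it√G₀} φ(h√G₀)` on `L²(ℝⁿ)`. -/
def wave (n : ℕ) (φ : ℝ → ℂ) (hφ : Continuous φ) (hc : HasCompactSupport φ) (t h : ℝ) :
    LpR n 2 →L[ℂ] LpR n 2 :=
  calcG₀ n (waveFun φ t h) (measurable_waveFun hφ t h) (bounded_waveFun hφ hc t h)

theorem one_le_bracket {V : Type*} [NormedAddCommGroup V] (x : V) : 1 ≤ bracket x :=
  Real.one_le_sqrt.2 (by nlinarith [sq_nonneg ‖x‖])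

theorem memLp_weight (n : ℕ) {a : ℝ} (ha : 0 ≤ a) :
    MemLp (fun x : Eucl n => ((bracket x ^ (-a) : ℝ) : ℂ)) ∞ volume := by
  refine memLp_top_of_bound (C := 1) ?_ (Filter.Eventually.of_forall fun x => ?_)
  · unfold bracket
    exact Measurable.aestronglyMeasurable (by fun_prop)
  · rw [Complex.norm_real, Real.norm_of_nonneg
      (Real.rpow_nonneg (zero_le_one.trans (one_le_bracket x)) _)]
    exact Real.rpow_le_one_of_one_le_of_nonpos (one_le_bracket x) (by linarith)

/-- Multiplication by `⟨x⟩^{-a}` on `L²(ℝⁿ)`, for `a ≥ 0`. -/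
def weight (n : ℕ) (a : ℝ) (ha : 0 ≤ a) : LpR n 2 →L[ℂ] LpR n 2 :=
  mulOp (fun x : Eucl n => ((bracket x ^ (-a) : ℝ) : ℂ)) (memLp_weight n ha)

/-- `U` is the bounded operator `L¹ → L^∞` that coincides with `T` on `L¹ ∩ L²`. As `L¹ ∩ L²` is
dense in `L¹`, there is at most one such `U`. -/
def IsExtension {n : ℕ} (T : LpR n 2 →L[ℂ] LpR n 2) (U : LpR n 1 →L[ℂ] LpR n ∞) : Prop :=
  ∀ (f : Eucl n → ℂ) (h1 : MemLp f 1 volume) (h2 : MemLp f 2 volume),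
    (U (h1.toLp f) : Eucl n → ℂ) =ᵐ[volume] (T (h2.toLp f) : Eucl n → ℂ)

end FreeWave

end

noncomputable section

namespace FreeWave

/-! ### Plancherel's theorem, and Fourier multipliers as convolutions -/

section Plancherel

open scoped SchwartzMap

variable {E : Type*} [NormedAddCommGroup E] [InnerProductSpace ℝ E] [FiniteDimensional ℝ E]
  [MeasurableSpace E] [BorelSpace E]

/-! The operator is convolution with `kernel`, the inverse Fourier transform of a compactly
supported symbol (`wave_ae_eq`), so all four estimates reduce to bounds on one function K_t(x).

In polar coordinates K_t(x) is an integral over a direction ν and a radius r, and each order of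
integration yields one bound. Integrating in r first gives h⁻ⁿ times a Schwartz function at (⟨ν, x⟩
+ t)/h. When 2‖x‖ ≤ |t| this argument has size at least |t|/(2h), so the kernel decays faster than
any power of |t|/h (`exists_kernel_decay`). Integrating over the sphere first shows that K_t(ρe) is,
in the variable t, the inverse Fourier transform of a profile of size O((hρ)^{-(n-1)/2}) supported
on an interval of length O(1/h) (`kernel_eq_fourierInv_profile`, `exists_norm_profile_le`). The L¹
norm of the profile bounds the kernel pointwise; its L² norm bounds the kernel in L² of time. The
size of the profile comes from the decay of the Fourier transform of surface measure, obtained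
without stationary phase: the divergence theorem gives Bessel's equation, and an energy inequality
bounds its solutions (`exists_norm_sphereMoment_le`).

The two kernel bounds together give the dispersive bound `exists_norm_kernel_le`, hence the L¹ → L^∞
estimate. For local decay, space is cut at |x| = |t|/4: outside the ball the weights decay in t,
inside it only the kernel away from the light cone is seen. The L² → L^∞ estimate is Cauchy–Schwarz,
followed by Hölder between Plancherel in x (s = 0) and the dispersive bound (s = (n-1)/2). The
time-integrated estimate is Cauchy–Schwarz against |f| dy and Tonelli, which leave the time integral
of |t|^{2s}|K_t(x)|², of size h⁻ⁿ|x|^{2s-(n-1)}, and a bounded convolution of that power with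
⟨x⟩^{-(1+2s+2ε)}. -/

theorem continuous_fourierInv_of_integrable {f : E → ℂ} (hf : Integrable f) :
    Continuous (𝓕⁻ f : E → ℂ) := by
  have h := (VectorFourier.fourierIntegral_continuous Real.continuous_fourierChar
    (L := innerₗ E) continuous_inner hf).comp continuous_neg
  convert h using 1
  ext x
  exact Real.fourierInv_eq_fourier_neg f x

theorem integral_fourierInv_mul_eq {f g : E → ℂ} (hf : Integrable f) (hg : Integrable g) :
    ∫ x, 𝓕⁻ f x * g x = ∫ x, f x * 𝓕⁻ g x := by
  have h := VectorFourier.integral_fourierIntegral_smul_eq_flip (L := innerₗ E) (μ := volume)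
    (ν := volume) Real.continuous_fourierChar continuous_inner hf hg.comp_neg
  rw [← integral_neg_eq_self]
  simp only [Real.fourierInv_eq_fourier_neg, neg_neg]
  refine h.trans (integral_congr_ae (Filter.Eventually.of_forall fun x => ?_))
  simp only [smul_eq_mul]
  congr 1
  rw [← Real.fourierInv_eq_fourier_neg, Real.fourierInv_eq_fourier_comp_neg, flip_innerₗ]
  rfl

/-- The inverse Fourier transform on `L²` is given by the Fourier integral on `L¹ ∩ L²`. -/
theorem fourierInv_toLp_ae_eq {f : E → ℂ} (h1 : MemLp f 1 volume) (h2 : MemLp f 2 volume) :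
    (𝓕⁻ (h2.toLp f : Lp (α := E) ℂ 2 volume) : Lp (α := E) ℂ 2 volume) =ᵐ[volume]
      (𝓕⁻ f : E → ℂ) := by
  have hi := memLp_one_iff_integrable.1 h1
  -- Both sides are locally integrable, so it suffices to test against smooth compactly supported
  -- functions. These are Schwartz, so the distributional transform moves 𝓕⁻ onto the test function,
  -- and the multiplication formula moves it back.
  refine ae_eq_of_integral_contDiff_smul_eq ?_ ?_ fun g hg hgc => ?_
  · exact (Lp.memLp
      (𝓕⁻ (h2.toLp f : Lp (α := E) ℂ 2 volume) : Lp (α := E) ℂ 2 volume)).locallyIntegrable (by norm_num)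
  · exact (continuous_fourierInv_of_integrable hi).locallyIntegrable
  · have hgc' : HasCompactSupport (fun x => (g x : ℂ)) := hgc.comp_left (g := Complex.ofReal) rfl
    let G : 𝓢(E, ℂ) := hgc'.toSchwartzMap (Complex.ofRealCLM.contDiff.comp hg)
    have e : ((𝓕⁻ (h2.toLp f : Lp (α := E) ℂ 2 volume) : Lp (α := E) ℂ 2 volume) : 𝓢'(E, ℂ)) G =
        (h2.toLp f : 𝓢'(E, ℂ)) (𝓕⁻ G) := by
      rw [← Lp.fourierInv_toTemperedDistribution_eq]; rfl
    rw [Lp.toTemperedDistribution_apply, Lp.toTemperedDistribution_apply] at e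
    have hG : ∀ x, G x = (g x : ℂ) := fun x => rfl
    have e2 : ∫ x, 𝓕⁻ G x • (h2.toLp f) x = ∫ x, (𝓕⁻ (G : E → ℂ)) x * f x := by
      refine integral_congr_ae ?_
      filter_upwards [h2.coeFn_toLp] with x hx
      rw [hx, SchwartzMap.fourierInv_coe, smul_eq_mul]
    rw [e2, integral_fourierInv_mul_eq G.integrable hi] at e
    simpa [hG] using e

/-- Plancherel's theorem for the Fourier integral on `L¹ ∩ L²`. -/
theorem eLpNorm_fourierInv_eq {f : E → ℂ} (h1 : MemLp f 1 volume) (h2 : MemLp f 2 volume) :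
    eLpNorm (𝓕⁻ f : E → ℂ) 2 volume = eLpNorm f 2 volume := by
  rw [← eLpNorm_congr_ae (fourierInv_toLp_ae_eq h1 h2), ← eLpNorm_congr_ae h2.coeFn_toLp]
  have := (Lp.fourierTransformₗᵢ E ℂ).symm.norm_map (h2.toLp f)
  rw [Lp.norm_def, Lp.norm_def, ENNReal.toReal_eq_toReal_iff' (Lp.eLpNorm_ne_top _)
    (Lp.eLpNorm_ne_top _)] at this
  exact this

end Plancherel

theorem mulOp_ae_eq {n : ℕ} {m : Eucl n → ℂ} (hm : MemLp m ∞ volume) (f : LpR n 2) :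
    mulOp m hm f =ᵐ[volume] fun x => m x * f x := by
  refine ((ContinuousLinearMap.mul ℂ ℂ).coeFn_holder (hm.toLp m) f).trans ?_
  filter_upwards [hm.coeFn_toLp] with x hx
  rw [hx]; rfl

/-- A Fourier multiplier whose symbol is in `L¹ ∩ L²` is a convolution operator on `L²`. -/
theorem fourierMul_ae_eq_convolution {n : ℕ} {m : Eucl n → ℂ} (hm : MemLp m ∞ volume)
    (h1 : MemLp m 1 volume) (h2 : MemLp m 2 volume) (f : LpR n 2) :
    fourierMul m hm f =ᵐ[volume] fun x => ∫ y, 𝓕⁻ m (x - y) * f y := by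
  set v : LpR n 2 := Lp.fourierTransformₗᵢ (Eucl n) ℂ f with hv
  have hmv2 : MemLp (fun ξ => m ξ * v ξ) 2 volume :=
    (memLp_congr_ae (mulOp_ae_eq hm v)).1 (Lp.memLp _)
  have hmv1 : MemLp (fun ξ => m ξ * v ξ) 1 volume := (Lp.memLp v).mul h2
  have e : fourierMul m hm f = 𝓕⁻ (hmv2.toLp _ : LpR n 2) := by
    have : mulOp m hm v = hmv2.toLp _ :=
      Lp.ext ((mulOp_ae_eq hm v).trans hmv2.coeFn_toLp.symm)
    rw [← this]; rfl
  rw [e]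
  refine (fourierInv_toLp_ae_eq hmv1 hmv2).trans (Filter.Eventually.of_forall fun x => ?_)
  -- With this choice ⟨a, v⟩ in L² is the inverse Fourier integral of m·v at x, and the conjugate of
  -- 𝓕⁻ a at y is 𝓕⁻ m (x - y). Unitarity of the transform then gives the convolution formula.
  set a : Eucl n → ℂ := fun ξ => (starRingEnd ℂ) ((Real.fourierChar (inner ℝ ξ x) : ℂ) * m ξ)
    with ha
  have hnorm : ∀ ξ, ‖a ξ‖ = ‖m ξ‖ := fun ξ => by
    rw [ha, RCLike.norm_conj, norm_mul, Circle.norm_coe, one_mul]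
  have hmeas : AEStronglyMeasurable a volume := by
    refine Complex.continuous_conj.comp_aestronglyMeasurable (AEStronglyMeasurable.mul ?_ h1.1)
    exact (Continuous.aestronglyMeasurable (by fun_prop))
  have ha1 : MemLp a 1 volume := h1.of_le hmeas (Filter.Eventually.of_forall fun ξ => (hnorm ξ).le)
  have ha2 : MemLp a 2 volume := h2.of_le hmeas (Filter.Eventually.of_forall fun ξ => (hnorm ξ).le)
  have hi := (Lp.fourierTransformₗᵢ (Eucl n) ℂ).symm.inner_map_map (ha2.toLp a) v
  rw [hv, LinearIsometryEquiv.symm_apply_apply, ← hv, L2.inner_def, L2.inner_def] at hi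
  have hr : ∫ ξ, inner ℂ (ha2.toLp a ξ) (v ξ) = 𝓕⁻ (fun ξ => m ξ * v ξ) x := by
    rw [Real.fourierInv_eq]
    refine integral_congr_ae ?_
    filter_upwards [ha2.coeFn_toLp] with ξ hξ
    rw [hξ, RCLike.inner_apply, ha, Circle.smul_def]
    simp; ring
  rw [← hr, ← hi]
  refine integral_congr_ae ?_
  filter_upwards [fourierInv_toLp_ae_eq ha1 ha2] with y hy
  have hy' : ((Lp.fourierTransformₗᵢ (Eucl n) ℂ).symm (ha2.toLp a)) y = 𝓕⁻ a y := hy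
  rw [hy', RCLike.inner_apply, mul_comm, Real.fourierInv_eq, Real.fourierInv_eq, ← integral_conj]
  congr 1
  refine integral_congr_ae (Filter.Eventually.of_forall fun ξ => ?_)
  have hx : inner ℝ ξ (x - y) = inner ℝ ξ x + -inner ℝ ξ y := by rw [inner_sub_right]; ring
  beta_reduce
  rw [hx, AddChar.map_add_eq_mul, AddChar.map_neg_eq_inv]
  simp only [ha, Circle.smul_def, smul_eq_mul, map_mul, Complex.conj_conj, Circle.coe_mul,
    Circle.coe_inv_eq_conj]
  ring

/-! ### Decay of the Fourier transform of surface measure on the sphere -/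

section Sphere

open Metric Set

theorem hasDerivAt_norm_add_smul {V : Type*} [NormedAddCommGroup V] [InnerProductSpace ℝ V]
    {η e : V} (h : η ≠ 0) :
    HasDerivAt (fun s : ℝ => ‖η + s • e‖) (inner ℝ η e / ‖η‖) 0 := by
  have h1 : HasDerivAt (fun s : ℝ => η + s • e) e 0 := by
    simpa using ((hasDerivAt_id (0 : ℝ)).smul_const e).const_add η
  have h2 := h1.norm_sq.sqrt (by simpa using h)
  simp only [Real.sqrt_sq (norm_nonneg _)] at h2
  convert h2 using 1
  simp
  field_simp

theorem abs_inner_sphere_le {V : Type*} [NormedAddCommGroup V] [InnerProductSpace ℝ V]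
    {e : V} (he : ‖e‖ = 1) (ν : sphere (0 : V) 1) :
    |inner ℝ ν.1 e| ≤ 1 := by
  have := abs_real_inner_le_norm ν.1 e
  rwa [he, norm_eq_of_mem_sphere ν, one_mul] at this

variable {E : Type*} [NormedAddCommGroup E] [InnerProductSpace ℝ E] [FiniteDimensional ℝ E]
  [MeasurableSpace E] [BorelSpace E]

theorem integrable_polar {F : Type*} [NormedAddCommGroup F] [NormedSpace ℝ F] [Nontrivial E]
    {f : E → F} (hf : Integrable f) :
    Integrable (fun p : sphere (0 : E) 1 × Ioi (0 : ℝ) => f (p.2.1 • p.1.1))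
      ((volume : Measure E).toSphere.prod (Measure.volumeIoiPow (Module.finrank ℝ E - 1))) := by
  have := (volume : Measure E).measurePreserving_homeomorphUnitSphereProd.symm
    (homeomorphUnitSphereProd E).toMeasurableEquiv
  refine (this.integrable_comp_emb (homeomorphUnitSphereProd E).symm.measurableEmbedding
    (g := fun x => f x.1)).2 ?_
  have h2 := (integrableOn_iff_comap_subtypeVal (μ := volume) (f := f)
    (measurableSet_singleton (0 : E)).compl).1 hf.integrableOn
  exact h2

theorem integral_polar {F : Type*} [NormedAddCommGroup F] [NormedSpace ℝ F] [Nontrivial E]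
    (f : E → F) :
    ∫ x, f x = ∫ p : sphere (0 : E) 1 × Ioi (0 : ℝ), f (p.2.1 • p.1.1)
      ∂((volume : Measure E).toSphere.prod (Measure.volumeIoiPow (Module.finrank ℝ E - 1))) := by
  have := (volume : Measure E).measurePreserving_homeomorphUnitSphereProd.symm
    (homeomorphUnitSphereProd E).toMeasurableEquiv
  have h1 := this.integral_comp (homeomorphUnitSphereProd E).symm.measurableEmbedding
    (g := fun x => f x.1)
  refine Eq.trans ?_ h1.symm
  rw [integral_subtype_comap (measurableSet_singleton _).compl f, restrict_compl_singleton]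

theorem integral_volumeIoiPow {F : Type*} [NormedAddCommGroup F] [NormedSpace ℝ F] (k : ℕ)
    (f : ℝ → F) :
    ∫ r : Ioi (0 : ℝ), f r ∂(Measure.volumeIoiPow k) = ∫ r in Ioi (0 : ℝ), r ^ k • f r := by
  simp only [Measure.volumeIoiPow, ENNReal.ofReal]
  rw [integral_withDensity_eq_integral_smul (by fun_prop),
    integral_subtype_comap measurableSet_Ioi fun r => Real.toNNReal (r ^ k) • f r]
  refine setIntegral_congr_fun measurableSet_Ioi fun r hr => ?_
  rw [NNReal.smul_def, Real.coe_toNNReal _ (pow_nonneg hr.out.le _)]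

theorem integrable_sphere {f : ℝ → ℂ} (hf : Continuous f) (e : E) :
    Integrable (fun ν : sphere (0 : E) 1 => f (inner ℝ ν.1 e)) (volume : Measure E).toSphere := by
  refine Continuous.integrable_of_hasCompactSupport (by fun_prop) ?_
  exact HasCompactSupport.of_compactSpace _

theorem integrable_of_bounded_of_support {f : E → ℂ} (hf : Measurable f) {B R : ℝ}
    (hb : ∀ x, ‖f x‖ ≤ B) (hR : ∀ x, R < ‖x‖ → f x = 0) : Integrable f := by
  have hs : Function.support f ⊆ closedBall 0 R := fun x hx => by
    by_contra h
    exact hx (hR x (by simpa using h))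
  rw [← integrableOn_iff_integrable_of_support_subset hs]
  exact Measure.integrableOn_of_bounded (M := B) measure_closedBall_lt_top.ne
    hf.aestronglyMeasurable (Filter.Eventually.of_forall hb)

/-- The divergence theorem on the sphere, for the gradient of `⟨·, e⟩` times a function of
`⟨·, e⟩`. -/
theorem integral_sphere_by_parts [Nontrivial E] {e : E} (he : ‖e‖ = 1) {g g' : ℝ → ℂ}
    (hg : ∀ u, HasDerivAt g (g' u) u) (hg' : Continuous g') {B : ℝ} (hB : ∀ u, ‖g u‖ ≤ B)
    (hB' : ∀ u, ‖g' u‖ ≤ B) :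
    ∫ ν : sphere (0 : E) 1, g' (inner ℝ ν.1 e) * (1 - (inner ℝ ν.1 e : ℝ) ^ 2)
        ∂(volume : Measure E).toSphere =
      ((Module.finrank ℝ E - 1 : ℕ) : ℂ) * ∫ ν : sphere (0 : E) 1,
        (inner ℝ ν.1 e : ℝ) * g (inner ℝ ν.1 e) ∂(volume : Measure E).toSphere := by
  have hB0 : 0 ≤ B := (norm_nonneg _).trans (hB 0)
  have hgc : Continuous g := continuous_iff_continuousAt.2 fun u => (hg u).continuousAt
  -- A radial cut-off supported in [1, 3], away from the origin, where `c` is singular. The function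
  -- Φ extends g(⟨ν, e⟩) off the sphere, constantly along rays up to this cut-off. The integral of
  -- its e-derivative vanishes, and in polar coordinates that identity factors into spherical and
  -- radial integrals.
  let ψ : ContDiffBump (2 : ℝ) := ⟨1 / 2, 1, by norm_num, by norm_num⟩
  have hψs : ∀ r, (r ≤ 1 ∨ 3 ≤ r) → ψ r = 0 := fun r hr => ψ.zero_of_le_dist (by
    rw [Real.dist_eq]; change 1 ≤ |r - 2|
    rcases hr with h | h
    · rw [abs_of_nonpos (by linarith)]; linarith
    · rw [abs_of_nonneg (by linarith)]; linarith)
  have hψd : ∀ r, HasDerivAt ψ (deriv ψ r) r := fun r =>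
    ((ψ.contDiff (n := 1)).differentiable (by norm_num) r).hasDerivAt
  have hψ'c : Continuous (deriv ψ) := (ψ.contDiff (n := 1)).continuous_deriv (by norm_num)
  have hψc : Continuous ψ := ψ.continuous
  have hdψ : ∀ r, (r < 1 ∨ 3 < r) → deriv ψ r = 0 := fun r hr => by
    have : ψ =ᶠ[nhds r] fun _ => 0 := by
      rcases hr with h | h
      · filter_upwards [Iio_mem_nhds h] with x hx using hψs x (Or.inl hx.le)
      · filter_upwards [Ioi_mem_nhds h] with x hx using hψs x (Or.inr (le_of_lt hx))
    rw [this.deriv_eq]; simp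
  have hψcs : HasCompactSupport ψ := ψ.hasCompactSupport
  obtain ⟨D, hD⟩ := hψ'c.bounded_above_of_compact_support hψcs.deriv
  have hD0 : 0 ≤ D := (norm_nonneg _).trans (hD 0)
  set c : E → ℝ := fun η => inner ℝ η e / ‖η‖ with hc
  have hcm : Measurable c := by fun_prop
  have hc1 : ∀ η, |c η| ≤ 1 := fun η => by
    rw [hc, abs_div, abs_norm]
    refine div_le_one_of_le₀ ?_ (norm_nonneg _)
    simpa [he] using abs_real_inner_le_norm η e
  set A₁ : E → ℂ := fun η => ((deriv ψ ‖η‖ : ℝ) : ℂ) * (c η * g (c η)) with hA₁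
  set A₂ : E → ℂ := fun η => ((ψ ‖η‖ / ‖η‖ : ℝ) : ℂ) * (g' (c η) * (1 - (c η : ℂ) ^ 2)) with hA₂
  set Φ : E → ℂ := fun η => (ψ ‖η‖ : ℂ) * g (c η) with hΦ
  have iA₁ : Integrable A₁ := by
    refine integrable_of_bounded_of_support (B := D * B) (R := 3) ?_ (fun η => ?_) fun η hη => ?_
    · exact (Complex.measurable_ofReal.comp (hψ'c.measurable.comp measurable_norm)).mul
        ((Complex.measurable_ofReal.comp hcm).mul (hgc.measurable.comp hcm))
    · rw [hA₁, norm_mul, norm_mul, Complex.norm_real, Complex.norm_real]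
      have : ‖c η‖ * ‖g (c η)‖ ≤ 1 * B := mul_le_mul (hc1 η) (hB _) (norm_nonneg _) zero_le_one
      rw [one_mul] at this
      exact mul_le_mul (hD _) this (by positivity) hD0
    · simp [hA₁, hdψ _ (Or.inr hη)]
  have iA₂ : Integrable A₂ := by
    refine integrable_of_bounded_of_support (B := 1 * (B * 2)) (R := 3) ?_ (fun η => ?_)
      fun η hη => ?_
    · exact (Complex.measurable_ofReal.comp
        ((hψc.measurable.comp measurable_norm).div measurable_norm)).mul
        ((hg'.measurable.comp hcm).mul (by fun_prop))
    · rw [hA₂, norm_mul, norm_mul, Complex.norm_real]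
      have h1 : ‖ψ ‖η‖ / ‖η‖‖ ≤ 1 := by
        rcases le_or_gt ‖η‖ 1 with h | h
        · simp [hψs _ (Or.inl h)]
        · rw [norm_div, norm_norm, Real.norm_of_nonneg ψ.nonneg]
          exact div_le_one_of_le₀ (ψ.le_one.trans h.le) (norm_nonneg _)
      have h2 : ‖1 - (c η : ℂ) ^ 2‖ ≤ 2 := by
        refine (norm_sub_le _ _).trans ?_
        rw [norm_pow, Complex.norm_real, norm_one]
        have : ‖c η‖ ^ 2 ≤ 1 := pow_le_one₀ (norm_nonneg _) (hc1 η)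
        linarith
      exact mul_le_mul h1 (mul_le_mul (hB' _) h2 (norm_nonneg _) hB0) (by positivity) zero_le_one
    · simp [hA₂, hψs _ (Or.inr hη.le)]
  have iΦ : Integrable Φ := by
    refine integrable_of_bounded_of_support (B := 1 * B) (R := 3) ?_ (fun η => ?_) fun η hη => ?_
    · exact (Complex.measurable_ofReal.comp (hψc.measurable.comp measurable_norm)).mul
        (hgc.measurable.comp hcm)
    · rw [hΦ, norm_mul, Complex.norm_real, Real.norm_of_nonneg ψ.nonneg]
      exact mul_le_mul ψ.le_one (hB _) (norm_nonneg _) zero_le_one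
    · simp [hΦ, hψs _ (Or.inr hη.le)]
  have hderiv : ∀ η, HasLineDerivAt ℝ Φ (A₁ η + A₂ η) η e := fun η => by
    unfold HasLineDerivAt
    rcases lt_or_ge ‖η‖ 1 with h | h
    · have h0 : A₁ η + A₂ η = 0 := by
        simp [hA₁, hA₂, hψs _ (Or.inl h.le), hdψ _ (Or.inl h)]
      rw [h0]
      refine (hasDerivAt_const (0 : ℝ) (0 : ℂ)).congr_of_eventuallyEq ?_
      have hcont : ContinuousAt (fun s : ℝ => ‖η + s • e‖) 0 := by fun_prop
      filter_upwards [hcont.eventually_lt continuousAt_const (by simpa using h)] with s hs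
      simp [hΦ, hψs _ (Or.inl hs.le)]
    · have hη : η ≠ 0 := by rintro rfl; simp at h; linarith
      have hn0 : ‖η‖ ≠ 0 := by linarith
      have d1 := hasDerivAt_norm_add_smul (e := e) hη
      have d2 : HasDerivAt (fun s : ℝ => inner ℝ (η + s • e) e) 1 0 := by
        have : (fun s : ℝ => inner ℝ (η + s • e) e) = fun s => inner ℝ η e + s := by
          ext s; rw [inner_add_left, real_inner_smul_left, real_inner_self_eq_norm_sq, he]; ring
        rw [this]; exact (hasDerivAt_id _).const_add _
      have d3 : HasDerivAt (fun s : ℝ => c (η + s • e)) ((1 - c η ^ 2) / ‖η‖) 0 := by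
        have := d2.div d1 (by simpa using hη)
        simp only [zero_smul, add_zero] at this
        refine this.congr_deriv ?_
        simp only [hc]; field_simp
      have d1' : HasDerivAt (fun s : ℝ => ψ ‖η + s • e‖) (deriv ψ ‖η‖ * c η) 0 := by
        have := HasDerivAt.comp (0 : ℝ) (h₂ := ψ) (h₂' := deriv ψ ‖η‖)
          (by simpa using hψd ‖η‖) d1
        exact this
      have d3' : HasDerivAt (fun s : ℝ => g (c (η + s • e)))
          (((1 - c η ^ 2) / ‖η‖ : ℝ) • g' (c η)) 0 := by
        have := HasDerivAt.scomp (0 : ℝ) (g₁ := g) (g₁' := g' (c η)) (by simpa using hg (c η)) d3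
        exact this
      have := d1'.ofReal_comp.mul d3'
      simp only [zero_smul, add_zero] at this
      refine this.congr_deriv ?_
      simp only [hA₁, hA₂, Complex.real_smul]; push_cast
      ring
  have hzero : ∫ η, (A₁ η + A₂ η) = 0 := by
    have := integral_bilinear_hasLineDerivAt_right_eq_neg_left_of_integrable (μ := volume)
      (f := fun _ : E => (1 : ℂ)) (f' := fun _ => 0) (g := Φ) (g' := fun η => A₁ η + A₂ η) (v := e)
      (B := ContinuousLinearMap.mul ℝ ℂ) (by simp) (by simpa [Pi.add_def] using iA₁.add iA₂)
      (by simpa using iΦ)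
      (fun η _ => by simpa [HasLineDerivAt] using hasDerivAt_const (0 : ℝ) (1 : ℂ))
      (fun η _ => hderiv η)
    simpa using this
  have hcs : ∀ (ν : sphere (0 : E) 1) (r : Ioi (0 : ℝ)), c (r.1 • ν.1) = inner ℝ ν.1 e := by
    intro ν r
    have hr : 0 < r.1 := r.2
    simp only [hc]
    rw [real_inner_smul_left, norm_smul, norm_eq_of_mem_sphere ν, Real.norm_of_nonneg hr.le]
    field_simp
  have hns : ∀ (ν : sphere (0 : E) 1) (r : Ioi (0 : ℝ)), ‖r.1 • ν.1‖ = r.1 := by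
    intro ν r
    have hr : 0 < r.1 := r.2
    rw [norm_smul, norm_eq_of_mem_sphere ν, Real.norm_of_nonneg hr.le, mul_one]
  set k := Module.finrank ℝ E - 1 with hk
  have p₁ : ∫ η, A₁ η = (∫ ν : sphere (0 : E) 1, (inner ℝ ν.1 e : ℝ) * g (inner ℝ ν.1 e)
      ∂(volume : Measure E).toSphere) * ∫ r in Ioi (0 : ℝ), r ^ k • ((deriv ψ r : ℝ) : ℂ) := by
    rw [integral_polar, ← integral_volumeIoiPow, ← integral_prod_mul]
    refine integral_congr_ae (Filter.Eventually.of_forall fun p => ?_)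
    simp only [hA₁, hcs, hns]
    ring
  have p₂ : ∫ η, A₂ η = (∫ ν : sphere (0 : E) 1, g' (inner ℝ ν.1 e) * (1 - (inner ℝ ν.1 e : ℝ) ^ 2)
      ∂(volume : Measure E).toSphere) * ∫ r in Ioi (0 : ℝ), r ^ k • ((ψ r / r : ℝ) : ℂ) := by
    rw [integral_polar, ← integral_volumeIoiPow, ← integral_prod_mul]
    refine integral_congr_ae (Filter.Eventually.of_forall fun p => ?_)
    simp only [hA₂, hcs, hns]
    ring
  set J : ℝ := ∫ r in Ioi (0 : ℝ), r ^ k * (ψ r / r) with hJ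
  have j₂ : ∫ r in Ioi (0 : ℝ), r ^ k • ((ψ r / r : ℝ) : ℂ) = (J : ℂ) := by
    rw [hJ, ← integral_complex_ofReal]
    refine integral_congr_ae (Filter.Eventually.of_forall fun r => ?_)
    simp
  -- Radial integration by parts produces the dimensional factor k. The common factor J is positive
  -- and cancels at the end.
  have j₁ : ∫ r in Ioi (0 : ℝ), r ^ k • ((deriv ψ r : ℝ) : ℂ) = -((k : ℝ) * J : ℝ) := by
    have e1 : ∫ r in Ioi (0 : ℝ), r ^ k • ((deriv ψ r : ℝ) : ℂ) =
        ((∫ r in Ioi (0 : ℝ), r ^ k * deriv ψ r : ℝ) : ℂ) := by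
      rw [← integral_complex_ofReal]
      refine integral_congr_ae (Filter.Eventually.of_forall fun r => ?_)
      simp
    have e2 : ∫ r in Ioi (0 : ℝ), r ^ k * deriv ψ r = ∫ r, r ^ k * deriv ψ r :=
      setIntegral_eq_integral_of_forall_compl_eq_zero fun r hr => by
        rw [hdψ r (Or.inl ((not_lt.1 hr).trans_lt one_pos)), mul_zero]
    have e3 : J = ∫ r, r ^ k * (ψ r / r) :=
      setIntegral_eq_integral_of_forall_compl_eq_zero fun r hr => by
        rw [hψs r (Or.inl ((not_lt.1 hr).trans zero_le_one)), zero_div, mul_zero]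
    have e4 := integral_mul_deriv_eq_deriv_mul_of_integrable (u := fun r : ℝ => r ^ k) (v := ψ)
      (fun r _ => hasDerivAt_pow k r) (fun r _ => hψd r)
      (Continuous.integrable_of_hasCompactSupport (by fun_prop) hψcs.deriv.mul_left)
      (Continuous.integrable_of_hasCompactSupport (by fun_prop) hψcs.mul_left)
      (Continuous.integrable_of_hasCompactSupport (by fun_prop) hψcs.mul_left)
    rw [e1, e2, e4, e3, ← integral_const_mul]
    norm_cast
    congr 1
    refine integral_congr_ae (Filter.Eventually.of_forall fun r => ?_)
    rcases eq_or_ne r 0 with rfl | hr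
    · simp [hψs 0 (Or.inl zero_le_one)]
    · rcases k with _ | j
      · simp
      · simp only [Nat.add_sub_cancel]
        field_simp
        ring
  have hJpos : 0 < J := by
    -- Since ψ vanishes on r ≤ 1, the denominator may be replaced by one bounded below, which makes
    -- continuity immediate.
    have hq : ∀ r, ψ r / r = ψ r / max r 1 := fun r => by
      rcases le_total r 1 with h | h
      · simp [hψs r (Or.inl h)]
      · rw [max_eq_left h]
    have hint : Integrable fun r : ℝ => r ^ k * (ψ r / r) := by
      simp only [hq]
      refine Continuous.integrable_of_hasCompactSupport ?_
        (HasCompactSupport.mul_left (hψcs.mul_right (f' := fun r => (max r 1)⁻¹)))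
      refine (continuous_pow k).mul (hψc.div (by fun_prop) fun r => ?_)
      exact (lt_of_lt_of_le one_pos (le_max_right r 1)).ne'
    rw [hJ, setIntegral_pos_iff_support_of_nonneg_ae ?_ hint.integrableOn]
    · refine lt_of_lt_of_le ?_ (measure_mono (s := Ioo (1 : ℝ) 3) fun r hr => ?_)
      · simp
      · have hr0 : 0 < r := one_pos.trans hr.1
        refine ⟨?_, hr0⟩
        have : 0 < ψ r := ψ.pos_of_mem_ball (by
          rw [mem_ball, Real.dist_eq]; change |r - 2| < 1
          rw [abs_lt]; constructor <;> linarith [hr.1, hr.2])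
        exact (by positivity : 0 < r ^ k * (ψ r / r)).ne'
    · filter_upwards [ae_restrict_mem measurableSet_Ioi] with r hr
      have hr0 : 0 < r := hr
      have : 0 ≤ ψ r := ψ.nonneg
      simp only [Pi.zero_apply]
      positivity
  rw [integral_add iA₁ iA₂, p₁, p₂, j₁, j₂] at hzero
  have hJ0 : (J : ℂ) ≠ 0 := by exact_mod_cast hJpos.ne'
  refine mul_right_cancel₀ hJ0 ?_
  push_cast at hzero
  linear_combination hzero

/-- The moment `∫ ⟨ν, e⟩ᵏ e^{ir⟨ν, e⟩} dσ(ν)` of the surface measure of the unit sphere. -/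
def sphereMoment (e : E) (k : ℕ) (r : ℝ) : ℂ :=
  ∫ ν : sphere (0 : E) 1, ((inner ℝ ν.1 e : ℝ) : ℂ) ^ k *
    Complex.exp (Complex.I * (r * inner ℝ ν.1 e : ℝ)) ∂(volume : Measure E).toSphere

theorem norm_sphereMoment_le {e : E} (he : ‖e‖ = 1) (k : ℕ) (r : ℝ) :
    ‖sphereMoment e k r‖ ≤ (volume : Measure E).toSphere.real univ := by
  have := norm_integral_le_of_norm_le_const (μ := (volume : Measure E).toSphere) (C := 1)
    (f := fun ν : sphere (0 : E) 1 => ((inner ℝ ν.1 e : ℝ) : ℂ) ^ k *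
      Complex.exp (Complex.I * (r * inner ℝ ν.1 e : ℝ))) (Filter.Eventually.of_forall fun ν => by
    rw [norm_mul, mul_comm Complex.I, Complex.norm_exp_ofReal_mul_I, mul_one, norm_pow,
      Complex.norm_real]
    exact pow_le_one₀ (norm_nonneg _) (abs_inner_sphere_le he ν))
  rwa [one_mul] at this

theorem hasDerivAt_sphereMoment {e : E} (he : ‖e‖ = 1) (k : ℕ) (r : ℝ) :
    HasDerivAt (sphereMoment e k) (Complex.I * sphereMoment e (k + 1) r) r := by
  have h := hasDerivAt_integral_of_dominated_loc_of_deriv_le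
    (μ := (volume : Measure E).toSphere) (s := univ) (x₀ := r) (bound := fun _ => 1)
    (F := fun (r : ℝ) (ν : sphere (0 : E) 1) => ((inner ℝ ν.1 e : ℝ) : ℂ) ^ k *
      Complex.exp (Complex.I * (r * inner ℝ ν.1 e : ℝ)))
    (F' := fun (r : ℝ) (ν : sphere (0 : E) 1) => Complex.I * (((inner ℝ ν.1 e : ℝ) : ℂ) ^ (k + 1) *
      Complex.exp (Complex.I * (r * inner ℝ ν.1 e : ℝ)))) Filter.univ_mem
    (Filter.Eventually.of_forall fun r => Continuous.aestronglyMeasurable (by fun_prop))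
    (integrable_sphere (f := fun u => (u : ℂ) ^ k * Complex.exp (Complex.I * (r * u : ℝ)))
      (by fun_prop) e)
    (Continuous.aestronglyMeasurable (by fun_prop))
    (Filter.Eventually.of_forall fun ν r _ => by
      rw [norm_mul, Complex.norm_I, one_mul, norm_mul, mul_comm Complex.I,
        Complex.norm_exp_ofReal_mul_I, mul_one, norm_pow, Complex.norm_real]
      exact pow_le_one₀ (norm_nonneg _) (abs_inner_sphere_le he ν))
    (integrable_const _)
    (Filter.Eventually.of_forall fun ν r _ => by
      have d1 : HasDerivAt (fun r : ℝ => Complex.I * ((r * inner ℝ ν.1 e : ℝ) : ℂ))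
          (Complex.I * ((1 * inner ℝ ν.1 e : ℝ) : ℂ)) r :=
        (((hasDerivAt_id r).mul_const _).ofReal_comp).const_mul _
      refine (d1.cexp.const_mul _).congr_deriv ?_
      rw [one_mul]; ring)
  refine h.2.congr_deriv ?_
  rw [sphereMoment, integral_const_mul]

/-- Bessel's equation for the Fourier transform of the surface measure. -/
theorem sphereMoment_bessel [Nontrivial E] {e : E} (he : ‖e‖ = 1) (r : ℝ) :
    Complex.I * r * (sphereMoment e 0 r - sphereMoment e 2 r) =
      ((Module.finrank ℝ E - 1 : ℕ) : ℂ) * sphereMoment e 1 r := by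
  have hb : ∀ u : ℝ, ‖Complex.exp (Complex.I * (r * u : ℝ))‖ = 1 := fun u => by
    rw [mul_comm Complex.I, Complex.norm_exp_ofReal_mul_I]
  -- For g(u) = e^{iru} the factor 1 - u² produces the difference of the moments of order 0 and 2.
  -- The constant max 1 |r| dominates both g and g'.
  have h := integral_sphere_by_parts he (g := fun u => Complex.exp (Complex.I * (r * u : ℝ)))
    (g' := fun u => Complex.I * r * Complex.exp (Complex.I * (r * u : ℝ))) (B := max 1 |r|)
    (fun u => by
      have d1 : HasDerivAt (fun u : ℝ => Complex.I * ((r * u : ℝ) : ℂ))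
          (Complex.I * ((r * 1 : ℝ) : ℂ)) u :=
        (((hasDerivAt_id u).const_mul _).ofReal_comp).const_mul _
      refine d1.cexp.congr_deriv ?_
      rw [mul_one]; ring)
    (by fun_prop) (fun u => (hb u).le.trans (le_max_left _ _)) (fun u => by
      rw [norm_mul, hb, mul_one, norm_mul, Complex.norm_I, one_mul, Complex.norm_real]
      exact le_max_right _ _)
  have e1 : sphereMoment e 1 r = ∫ ν : sphere (0 : E) 1, ((inner ℝ ν.1 e : ℝ) : ℂ) *
      Complex.exp (Complex.I * (r * inner ℝ ν.1 e : ℝ)) ∂(volume : Measure E).toSphere := by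
    simp [sphereMoment]
  rw [e1, ← h, sphereMoment, sphereMoment, ← integral_sub, ← integral_const_mul]
  · refine integral_congr_ae (Filter.Eventually.of_forall fun ν => ?_)
    simp only
    ring
  · exact integrable_sphere (f := fun u => (u : ℂ) ^ 0 * Complex.exp (Complex.I * (r * u : ℝ)))
      (by fun_prop) e
  · exact integrable_sphere (f := fun u => (u : ℂ) ^ 2 * Complex.exp (Complex.I * (r * u : ℝ)))
      (by fun_prop) e

/-- A solution of `w'' = (b / r² - 1) w` on `[1, ∞)` is bounded there. -/
theorem norm_le_of_bessel {w v : ℝ → ℂ} {b : ℝ}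
    (hw : ∀ r, 0 < r → HasDerivAt w (v r) r)
    (hv : ∀ r, 0 < r → HasDerivAt v (((b / r ^ 2 - 1 : ℝ) : ℂ) * w r) r) {r : ℝ} (hr : 1 ≤ r) :
    ‖w r‖ ^ 2 ≤ (‖w 1‖ ^ 2 + ‖v 1‖ ^ 2) * Real.exp |b| := by
  -- The derivative of the energy ‖w‖² + ‖v‖² is 2(b/r²)⟨w, v⟩, at most |b|/r² times the energy. The
  -- factor exp(|b|/r) has logarithmic derivative -|b|/r² and compensates exactly, so N is
  -- nonincreasing.
  set N : ℝ → ℝ := fun r => (‖w r‖ ^ 2 + ‖v r‖ ^ 2) * Real.exp (|b| * r⁻¹) with hN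
  have hd : ∀ r, 0 < r → HasDerivAt N
      ((2 * inner ℝ (w r) (v r) + 2 * inner ℝ (v r) (((b / r ^ 2 - 1 : ℝ) : ℂ) * w r)) *
        Real.exp (|b| * r⁻¹) + (‖w r‖ ^ 2 + ‖v r‖ ^ 2) *
          (Real.exp (|b| * r⁻¹) * (|b| * (-(r ^ 2)⁻¹)))) r := fun r hr =>
    ((hw r hr).norm_sq.add (hv r hr).norm_sq).mul
      (((hasDerivAt_inv hr.ne').const_mul |b|).exp)
  have hanti : AntitoneOn N (Ici 1) := by
    refine antitoneOn_of_deriv_nonpos (convex_Ici 1) (fun r hr => ?_) (fun r hr => ?_) fun r hr => ?_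
    · exact (hd r (one_pos.trans_le hr)).continuousAt.continuousWithinAt
    · rw [interior_Ici] at hr
      exact (hd r (one_pos.trans hr)).differentiableAt.differentiableWithinAt
    · rw [interior_Ici] at hr
      have hr0 : 0 < r := one_pos.trans hr
      rw [(hd r hr0).deriv]
      have e1 : inner ℝ (v r) (((b / r ^ 2 - 1 : ℝ) : ℂ) * w r) =
          (b / r ^ 2 - 1) * inner ℝ (w r) (v r) := by
        rw [← Complex.real_smul, real_inner_smul_right, real_inner_comm]
      rw [e1]
      have h1 : |inner ℝ (w r) (v r)| ≤ (‖w r‖ ^ 2 + ‖v r‖ ^ 2) / 2 := by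
        have := abs_real_inner_le_norm (w r) (v r)
        nlinarith [sq_nonneg (‖w r‖ - ‖v r‖)]
      have h2 : b * inner ℝ (w r) (v r) ≤ |b| * ((‖w r‖ ^ 2 + ‖v r‖ ^ 2) / 2) := by
        refine (le_abs_self _).trans ?_
        rw [abs_mul]
        exact mul_le_mul_of_nonneg_left h1 (abs_nonneg b)
      have e2 : (2 * inner ℝ (w r) (v r) + 2 * ((b / r ^ 2 - 1) * inner ℝ (w r) (v r))) *
          Real.exp (|b| * r⁻¹) + (‖w r‖ ^ 2 + ‖v r‖ ^ 2) *
            (Real.exp (|b| * r⁻¹) * (|b| * (-(r ^ 2)⁻¹))) =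
          -(2 * Real.exp (|b| * r⁻¹) * (r ^ 2)⁻¹ *
            (|b| * ((‖w r‖ ^ 2 + ‖v r‖ ^ 2) / 2) - b * inner ℝ (w r) (v r))) := by
        field_simp; ring
      rw [e2, neg_nonpos]
      exact mul_nonneg (by positivity) (by linarith)
  have h1 := hanti (mem_Ici.2 le_rfl) hr hr
  simp only [hN, inv_one, mul_one] at h1
  refine le_trans ?_ h1
  have hr0 : 0 < r := one_pos.trans_le hr
  have h2 : 1 ≤ Real.exp (|b| * r⁻¹) := Real.one_le_exp (by positivity)
  nlinarith [sq_nonneg ‖w r‖, sq_nonneg ‖v r‖]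

/-- Write m for the moment of order 0 and a for half of the dimension minus one. By
`hasDerivAt_sphereMoment`, Bessel's equation reads m'' + (2a/r) m' + m = 0. The substitution w = rᵃ
m removes the first-order term and leaves w'' = (a(a-1)/r² - 1) w, to which `norm_le_of_bessel`
applies. The data at r = 1 are controlled by the total mass S, so the constant is independent of e.
-/
theorem exists_norm_sphereMoment_le [Nontrivial E] :
    ∃ C : ℝ, 0 < C ∧ ∀ (e : E) (r : ℝ), ‖e‖ = 1 → 0 < r →
      ‖sphereMoment e 0 r‖ ≤ C * r ^ (-(((Module.finrank ℝ E : ℝ) - 1) / 2)) := by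
  set S := (volume : Measure E).toSphere.real univ with hS
  have hS0 : 0 ≤ S := measureReal_nonneg
  set a : ℝ := ((Module.finrank ℝ E : ℝ) - 1) / 2 with ha
  have hfin : 1 ≤ Module.finrank ℝ E := Module.finrank_pos
  have hk : (((Module.finrank ℝ E - 1 : ℕ)) : ℂ) = 2 * (a : ℂ) := by
    rw [ha]; push_cast [Nat.cast_sub hfin]; ring
  have ha0 : 0 ≤ a := by
    have : (1 : ℝ) ≤ Module.finrank ℝ E := by exact_mod_cast hfin
    rw [ha]; linarith
  set b := a * (a - 1)
  set K : ℝ := (S ^ 2 + (a * S + S) ^ 2) * Real.exp |b| with hK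
  refine ⟨max (Real.sqrt K) S + 1, by positivity, fun e r he hr => ?_⟩
  have hbd := fun k r => norm_sphereMoment_le he k r
  -- For r ≤ 1 the total mass is enough, since r^{-a} ≥ 1.
  rcases le_total r 1 with h1 | h1
  · have : 1 ≤ r ^ (-a) := Real.one_le_rpow_of_pos_of_le_one_of_nonpos hr h1 (by linarith)
    calc _ ≤ S := hbd 0 r
      _ ≤ (max (Real.sqrt K) S + 1) * 1 := by linarith [le_max_right (Real.sqrt K) S]
      _ ≤ _ := by gcongr
  set w : ℝ → ℂ := fun r => ((r ^ a : ℝ) : ℂ) * sphereMoment e 0 r with hw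
  set v : ℝ → ℂ := fun r => ((a * r ^ (a - 1) : ℝ) : ℂ) * sphereMoment e 0 r +
    ((r ^ a : ℝ) : ℂ) * (Complex.I * sphereMoment e 1 r) with hv
  have dp : ∀ (p r : ℝ), 0 < r → HasDerivAt (fun r : ℝ => ((r ^ p : ℝ) : ℂ))
      ((p * r ^ (p - 1) : ℝ) : ℂ) r := fun p r hr =>
    (Real.hasDerivAt_rpow_const (Or.inl hr.ne')).ofReal_comp
  have dw : ∀ r, 0 < r → HasDerivAt w (v r) r := fun r hr =>
    (dp a r hr).mul (hasDerivAt_sphereMoment he 0 r)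
  have dv : ∀ r, 0 < r → HasDerivAt v (((b / r ^ 2 - 1 : ℝ) : ℂ) * w r) r := fun r hr => by
    have dp' : HasDerivAt (fun r : ℝ => ((a * r ^ (a - 1) : ℝ) : ℂ))
        ((a * ((a - 1) * r ^ (a - 1 - 1)) : ℝ) : ℂ) r :=
      ((Real.hasDerivAt_rpow_const (Or.inl hr.ne')).const_mul a).ofReal_comp
    refine ((dp'.mul (hasDerivAt_sphereMoment he 0 r)).add ((dp a r hr).mul
      ((hasDerivAt_sphereMoment he 1 r).const_mul Complex.I))).congr_deriv ?_
    have hrc : (r : ℂ) ≠ 0 := by exact_mod_cast hr.ne'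
    have hB := sphereMoment_bessel he r
    rw [hk] at hB
    rw [Real.rpow_sub_one hr.ne', Real.rpow_sub_one hr.ne', hw]
    push_cast
    have hq : (r : ℂ) * (r : ℂ)⁻¹ = 1 := mul_inv_cancel₀ hrc
    have hb : (b : ℂ) = a * (a - 1) := by push_cast [b]; ring
    rw [hb]
    linear_combination (-(((r ^ a : ℝ) : ℂ) * (r : ℂ)⁻¹ * Complex.I)) * hB +
      ((r ^ a : ℝ) : ℂ) * (sphereMoment e 0 r - sphereMoment e 2 r) * Complex.I ^ 2 * hq +
      ((r ^ a : ℝ) : ℂ) * sphereMoment e 0 r * Complex.I_sq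
  have hmain := norm_le_of_bessel dw dv h1
  have hw1 : ‖w 1‖ ^ 2 + ‖v 1‖ ^ 2 ≤ S ^ 2 + (a * S + S) ^ 2 := by
    have h2 : ‖w 1‖ ≤ S := by
      have : w 1 = sphereMoment e 0 1 := by simp [hw]
      rw [this]; exact hbd 0 1
    have h3 : ‖v 1‖ ≤ a * S + S := by
      have : v 1 = (a : ℂ) * sphereMoment e 0 1 + Complex.I * sphereMoment e 1 1 := by simp [hv]
      rw [this]
      refine (norm_add_le _ _).trans ?_
      rw [norm_mul, norm_mul, Complex.norm_I, one_mul, Complex.norm_real, Real.norm_of_nonneg ha0]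
      exact add_le_add (mul_le_mul_of_nonneg_left (hbd 0 1) ha0) (hbd 1 1)
    gcongr
  have h4 : ‖w r‖ ≤ Real.sqrt K := by
    refine Real.le_sqrt_of_sq_le (hmain.trans ?_)
    rw [hK]; gcongr
  have h5 : ‖w r‖ = r ^ a * ‖sphereMoment e 0 r‖ := by
    rw [hw, norm_mul, Complex.norm_real, Real.norm_of_nonneg (by positivity)]
  rw [Real.rpow_neg hr.le, ← div_eq_mul_inv, le_div_iff₀ (by positivity), mul_comm, ← h5]
  linarith [le_max_left (Real.sqrt K) S]

end Sphere

/-! ### The convolution kernel in polar coordinates -/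

section Kernel

open Metric Set
open scoped SchwartzMap

/-- The symbol `e^{it2π|ξ|} φ(h2π|ξ|)` of the operator `e^{it√G₀} φ(h√G₀)`. -/
def symbol (n : ℕ) (φ : ℝ → ℂ) (t h : ℝ) (ξ : Eucl n) : ℂ :=
  waveFun φ t h ((2 * Real.pi * ‖ξ‖) ^ 2)

/-- The convolution kernel of `e^{it√G₀} φ(h√G₀)`. -/
def kernel (n : ℕ) (φ : ℝ → ℂ) (t h : ℝ) : Eucl n → ℂ := 𝓕⁻ (symbol n φ t h)

variable {n : ℕ} {φ : ℝ → ℂ}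

theorem symbol_eq (t h : ℝ) (ξ : Eucl n) :
    symbol n φ t h ξ = Complex.exp (Complex.I * (t * (2 * Real.pi * ‖ξ‖) : ℝ)) *
      φ (h * (2 * Real.pi * ‖ξ‖)) := by
  rw [symbol, waveFun, Real.sqrt_sq (by positivity)]

theorem continuous_symbol (hφ : Continuous φ) :
    Continuous fun p : ℝ × ℝ × Eucl n => symbol n φ p.1 p.2.1 p.2.2 := by
  simp only [symbol_eq]
  fun_prop

theorem norm_symbol (t h : ℝ) (ξ : Eucl n) :
    ‖symbol n φ t h ξ‖ = ‖φ (h * (2 * Real.pi * ‖ξ‖))‖ := by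
  rw [symbol_eq, norm_mul, mul_comm Complex.I, Complex.norm_exp_ofReal_mul_I, one_mul]

theorem eq_zero_of_nonpos (hsupp : tsupport φ ⊆ Ioi 0) {r : ℝ} (hr : r ≤ 0) : φ r = 0 :=
  image_eq_zero_of_notMem_tsupport fun h => absurd (hsupp h) (not_lt.2 hr)

theorem exists_forall_lt_eq_zero (hc : HasCompactSupport φ) :
    ∃ b : ℝ, 0 < b ∧ ∀ r, b < r → φ r = 0 := by
  obtain ⟨b, hb⟩ := hc.isCompact.isBounded.subset_closedBall (0 : ℝ)
  refine ⟨max b 1, by positivity, fun r hr => image_eq_zero_of_notMem_tsupport fun h => ?_⟩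
  have := hb h
  rw [mem_closedBall, dist_zero_right, Real.norm_eq_abs] at this
  linarith [le_abs_self r, le_max_left b 1]

theorem symbol_eq_zero {b h : ℝ} (hb : ∀ r, b < r → φ r = 0) (hh : 0 < h) (t : ℝ) {ξ : Eucl n}
    (hξ : b / (2 * Real.pi * h) < ‖ξ‖) : symbol n φ t h ξ = 0 := by
  rw [symbol_eq, hb, mul_zero]
  rw [div_lt_iff₀ (by positivity)] at hξ
  linarith

theorem hasCompactSupport_symbol (hc : HasCompactSupport φ) {h : ℝ} (hh : 0 < h) (t : ℝ) :
    HasCompactSupport (symbol n φ t h) := by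
  obtain ⟨b, -, hb⟩ := exists_forall_lt_eq_zero hc
  refine HasCompactSupport.of_support_subset_isCompact
    (isCompact_closedBall (0 : Eucl n) (b / (2 * Real.pi * h))) fun ξ hξ => ?_
  by_contra h'
  exact hξ (symbol_eq_zero hb hh t (by simpa using h'))

theorem memLp_symbol_of_pos (hφ : Continuous φ) (hc : HasCompactSupport φ) {h : ℝ} (hh : 0 < h)
    (t : ℝ) (p : ℝ≥0∞) : MemLp (symbol n φ t h) p volume :=
  Continuous.memLp_of_hasCompactSupport
    ((continuous_symbol hφ).comp (by fun_prop : Continuous fun ξ : Eucl n => (t, h, ξ)))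
    (hasCompactSupport_symbol hc hh t)

theorem integrable_symbol (hφ : Continuous φ) (hc : HasCompactSupport φ) {h : ℝ} (hh : 0 < h)
    (t : ℝ) : Integrable (symbol n φ t h) :=
  memLp_one_iff_integrable.1 (memLp_symbol_of_pos hφ hc hh t 1)

theorem wave_ae_eq (hφ : Continuous φ) (hc : HasCompactSupport φ) {h : ℝ} (hh : 0 < h) (t : ℝ)
    (f : LpR n 2) :
    wave n φ hφ hc t h f =ᵐ[volume] fun x => ∫ y, kernel n φ t h (x - y) * f y :=
  fourierMul_ae_eq_convolution _ (memLp_symbol_of_pos hφ hc hh t 1)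
    (memLp_symbol_of_pos hφ hc hh t 2) f

theorem continuous_kernel (hφ : Continuous φ) (hc : HasCompactSupport φ) {h : ℝ} (hh : 0 < h) :
    Continuous fun p : ℝ × Eucl n => kernel n φ p.1 h p.2 := by
  simp only [kernel, Real.fourierInv_eq]
  refine continuous_of_dominated (bound := fun ξ => ‖symbol n φ 0 h ξ‖) (fun p => ?_) (fun p => ?_)
    (integrable_symbol hφ hc hh 0).norm ?_
  · refine Continuous.aestronglyMeasurable (Continuous.smul (by fun_prop) ?_)
    exact (continuous_symbol hφ).comp (by fun_prop : Continuous fun ξ : Eucl n => (p.1, h, ξ))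
  · refine Filter.Eventually.of_forall fun ξ => ?_
    rw [Circle.norm_smul, norm_symbol, norm_symbol]
  · refine Filter.Eventually.of_forall fun ξ => Continuous.smul (by fun_prop) ?_
    exact (continuous_symbol hφ).comp
      (by fun_prop : Continuous fun p : ℝ × Eucl n => (p.1, h, ξ))

/-- The polar form of the integrand defining the kernel. -/
theorem polar_integrand (t h : ℝ) (x : Eucl n) (ν : sphere (0 : Eucl n) 1) {r : ℝ} (hr : 0 < r) :
    Complex.exp ((2 * Real.pi * inner ℝ (r • ν.1) x : ℝ) * Complex.I) • symbol n φ t h (r • ν.1) =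
      Complex.exp (Complex.I * (2 * Real.pi * r * inner ℝ ν.1 x : ℝ)) *
        (Complex.exp (Complex.I * (2 * Real.pi * (r * t) : ℝ)) * φ (2 * Real.pi * h * r)) := by
  rw [symbol_eq, norm_smul, norm_eq_of_mem_sphere ν, Real.norm_of_nonneg hr.le,
    real_inner_smul_left, smul_eq_mul]
  have e1 : ((2 * Real.pi * (r * inner ℝ ν.1 x) : ℝ) : ℂ) * Complex.I =
      Complex.I * (2 * Real.pi * r * inner ℝ ν.1 x : ℝ) := by push_cast; ring
  have e2 : t * (2 * Real.pi * (r * 1)) = 2 * Real.pi * (r * t) := by ring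
  have e3 : h * (2 * Real.pi * (r * 1)) = 2 * Real.pi * h * r := by ring
  rw [e1, e2, e3]

theorem integrable_polar_kernel [NeZero n] (hφ : Continuous φ) (hc : HasCompactSupport φ) {h : ℝ}
    (hh : 0 < h) (t : ℝ) (x : Eucl n) :
    Integrable (fun p : sphere (0 : Eucl n) 1 × Ioi (0 : ℝ) =>
      Complex.exp (Complex.I * (2 * Real.pi * p.2.1 * inner ℝ p.1.1 x : ℝ)) *
        (Complex.exp (Complex.I * (2 * Real.pi * (p.2.1 * t) : ℝ)) * φ (2 * Real.pi * h * p.2.1)))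
      ((volume : Measure (Eucl n)).toSphere.prod (Measure.volumeIoiPow (n - 1))) := by
  have h0 : Integrable fun ξ : Eucl n =>
      Complex.exp ((2 * Real.pi * inner ℝ ξ x : ℝ) * Complex.I) • symbol n φ t h ξ := by
    have hcont : Continuous fun ξ : Eucl n =>
      Complex.exp ((2 * Real.pi * inner ℝ ξ x : ℝ) * Complex.I) := by fun_prop
    refine (integrable_symbol hφ hc hh t).bdd_smul 1 hcont.aestronglyMeasurable
      (Filter.Eventually.of_forall fun ξ => ?_)
    rw [Complex.norm_exp_ofReal_mul_I]
  have h1 := integrable_polar h0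
  rw [finrank_euclideanSpace_fin] at h1
  exact h1.congr (Filter.Eventually.of_forall fun p => polar_integrand t h x p.1 p.2.2)

theorem kernel_eq_polar [NeZero n] (t h : ℝ) (x : Eucl n) :
    kernel n φ t h x = ∫ p : sphere (0 : Eucl n) 1 × Ioi (0 : ℝ),
      Complex.exp (Complex.I * (2 * Real.pi * p.2.1 * inner ℝ p.1.1 x : ℝ)) *
        (Complex.exp (Complex.I * (2 * Real.pi * (p.2.1 * t) : ℝ)) * φ (2 * Real.pi * h * p.2.1))
      ∂((volume : Measure (Eucl n)).toSphere.prod (Measure.volumeIoiPow (n - 1))) := by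
  rw [kernel, Real.fourierInv_eq', integral_polar, finrank_euclideanSpace_fin]
  exact integral_congr_ae (Filter.Eventually.of_forall fun p => polar_integrand t h x p.1 p.2.2)

/-- The kernel at `x = ρ e` is, as a function of time, the inverse Fourier transform of this
function. -/
def profile (n : ℕ) (φ : ℝ → ℂ) (h : ℝ) (e : Eucl n) (ρ : ℝ) (r : ℝ) : ℂ :=
  (r ^ (n - 1) : ℝ) * φ (2 * Real.pi * h * r) * sphereMoment e 0 (2 * Real.pi * r * ρ)

/-- Fubini with the sphere integral inside. The support of φ lets the radial integral run over the
whole line, and t then enters only as the Fourier variable. -/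
theorem kernel_eq_fourierInv_profile [NeZero n] (hφ : Continuous φ) (hc : HasCompactSupport φ)
    (hsupp : tsupport φ ⊆ Ioi 0) {h : ℝ} (hh : 0 < h) (e : Eucl n) (ρ t : ℝ) :
    kernel n φ t h (ρ • e) = 𝓕⁻ (profile n φ h e ρ) t := by
  rw [kernel_eq_polar, integral_prod_symm _ (integrable_polar_kernel hφ hc hh t _)]
  rw [integral_volumeIoiPow (n - 1) fun r => ∫ ν : sphere (0 : Eucl n) 1,
      Complex.exp (Complex.I * (2 * Real.pi * r * inner ℝ ν.1 (ρ • e) : ℝ)) *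
        (Complex.exp (Complex.I * (2 * Real.pi * (r * t) : ℝ)) * φ (2 * Real.pi * h * r))
      ∂(volume : Measure (Eucl n)).toSphere, Real.fourierInv_eq']
  rw [setIntegral_eq_integral_of_forall_compl_eq_zero fun r hr => ?_]
  · refine integral_congr_ae (Filter.Eventually.of_forall fun r => ?_)
    simp only [integral_mul_const, profile, sphereMoment, pow_zero, one_mul, smul_eq_mul,
      Complex.real_smul]
    have e1 : ∀ ν : sphere (0 : Eucl n) 1, 2 * Real.pi * r * inner ℝ ν.1 (ρ • e) =
        2 * Real.pi * r * ρ * inner ℝ ν.1 e := fun ν => by rw [real_inner_smul_right]; ring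
    simp only [e1]
    have e2 : ((2 * Real.pi * inner ℝ r t : ℝ) : ℂ) * Complex.I =
        Complex.I * (2 * Real.pi * (r * t) : ℝ) := by
      rw [real_inner_comm]; simp; ring
    rw [e2]
    ring
  · rw [eq_zero_of_nonpos hsupp
      (mul_nonpos_of_nonneg_of_nonpos (by positivity) (not_lt.1 hr))]
    simp

/-- The two phases merge into one of frequency u + t, and the substitution r ↦ hr removes h from φ.
What remains of h is a prefactor and a dilation of the argument, which is the source of uniformity
in h. -/
theorem integral_radial_eq (hsupp : tsupport φ ⊆ Ioi 0) {h : ℝ} (hn : 1 ≤ n) (hh : 0 < h)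
    (u t : ℝ) :
    ∫ r in Ioi (0 : ℝ), r ^ (n - 1) • (Complex.exp (Complex.I * (2 * Real.pi * r * u : ℝ)) *
        (Complex.exp (Complex.I * (2 * Real.pi * (r * t) : ℝ)) * φ (2 * Real.pi * h * r))) =
      ((h ^ n)⁻¹ : ℝ) * 𝓕⁻ (fun r : ℝ => ((r ^ (n - 1) : ℝ) : ℂ) * φ (2 * Real.pi * r))
        ((u + t) / h) := by
  rw [setIntegral_eq_integral_of_forall_compl_eq_zero fun r hr => ?_]
  · rw [Real.fourierInv_eq']
    set G : ℝ → ℂ := fun r => Complex.exp ((2 * Real.pi * inner ℝ r ((u + t) / h) : ℝ) * Complex.I) •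
      (((r ^ (n - 1) : ℝ) : ℂ) * φ (2 * Real.pi * r)) with hG
    have e1 := Measure.integral_comp_mul_left G h
    have e2 : ∀ r : ℝ, r ^ (n - 1) • (Complex.exp (Complex.I * (2 * Real.pi * r * u : ℝ)) *
        (Complex.exp (Complex.I * (2 * Real.pi * (r * t) : ℝ)) * φ (2 * Real.pi * h * r))) =
        ((h ^ (n - 1))⁻¹ : ℝ) * G (h * r) := fun r => by
      have e3 : ((2 * Real.pi * inner ℝ (h * r) ((u + t) / h) : ℝ) : ℂ) * Complex.I =
          Complex.I * (2 * Real.pi * r * u : ℝ) + Complex.I * (2 * Real.pi * (r * t) : ℝ) := by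
        have : inner ℝ (h * r) ((u + t) / h) = r * u + r * t := by
          simp only [RCLike.inner_apply, conj_trivial]; field_simp
        rw [this]; push_cast; ring
      have e4 : 2 * Real.pi * (h * r) = 2 * Real.pi * h * r := by ring
      have hh' : (h : ℂ) ^ (n - 1) ≠ 0 := by
        have : (h : ℂ) ≠ 0 := by exact_mod_cast hh.ne'
        exact pow_ne_zero _ this
      simp only [hG]
      rw [e3, Complex.exp_add, e4, mul_pow, smul_eq_mul, Complex.real_smul]
      push_cast
      field_simp
    simp only [e2]
    rw [integral_const_mul, e1, Complex.real_smul, ← mul_assoc]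
    congr 1
    rw [abs_of_pos (inv_pos.2 hh), ← Complex.ofReal_mul, ← mul_inv, ← pow_succ,
      Nat.sub_add_cancel hn]
  · rw [eq_zero_of_nonpos hsupp
      (mul_nonpos_of_nonneg_of_nonpos (by positivity) (not_lt.1 hr))]
    simp

/-- Away from the light cone the kernel decays rapidly. -/
theorem exists_kernel_decay [NeZero n] (hφ : ContDiff ℝ ∞ φ) (hc : HasCompactSupport φ)
    (hsupp : tsupport φ ⊆ Ioi 0) (N : ℕ) :
    ∃ C : ℝ, 0 < C ∧ ∀ (h t : ℝ) (x : Eucl n), 0 < h → 2 * ‖x‖ ≤ |t| →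
      ‖kernel n φ t h x‖ ≤ C * (h ^ n)⁻¹ * ((1 + |t| / h) ^ N)⁻¹ := by
  have hn : 1 ≤ n := Nat.one_le_iff_ne_zero.2 (NeZero.ne n)
  set ψ : ℝ → ℂ := fun r => ((r ^ (n - 1) : ℝ) : ℂ) * φ (2 * Real.pi * r) with hψ
  have hψs : ContDiff ℝ ∞ ψ := by
    refine ContDiff.mul ?_ (hφ.comp (by fun_prop))
    exact Complex.ofRealCLM.contDiff.comp (contDiff_id.pow (n - 1))
  have hψc : HasCompactSupport ψ := by
    refine HasCompactSupport.mul_left ?_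
    exact hc.comp_homeomorph (Homeomorph.mulLeft₀ (2 * Real.pi) (by positivity))
  let Ψ : 𝓢(ℝ, ℂ) := hψc.toSchwartzMap hψs
  have hΨ : ((𝓕⁻ Ψ : 𝓢(ℝ, ℂ)) : ℝ → ℂ) = 𝓕⁻ ψ := SchwartzMap.fourierInv_coe Ψ
  set C₀ : ℝ := 2 ^ N * (Finset.Iic (N, 0)).sup
    (fun m : ℕ × ℕ => SchwartzMap.seminorm ℝ m.1 m.2) (𝓕⁻ Ψ : 𝓢(ℝ, ℂ)) with hC₀
  have hdec : ∀ τ : ℝ, (1 + |τ|) ^ N * ‖𝓕⁻ ψ τ‖ ≤ C₀ := fun τ => by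
    have := SchwartzMap.one_add_le_sup_seminorm_apply (𝕜 := ℝ) (m := (N, 0)) (k := N) (n := 0)
      le_rfl le_rfl (𝓕⁻ Ψ : 𝓢(ℝ, ℂ)) τ
    rwa [norm_iteratedFDeriv_zero, hΨ, Real.norm_eq_abs] at this
  have hC₀0 : 0 ≤ C₀ := le_trans (by positivity) (hdec 0)
  set S := (volume : Measure (Eucl n)).toSphere.real univ with hS
  have hS0 : 0 ≤ S := measureReal_nonneg
  refine ⟨C₀ * 2 ^ N * S + 1, by positivity, fun h t x hh hxt => ?_⟩
  rw [kernel_eq_polar, integral_prod _ (integrable_polar_kernel hφ.continuous hc hh t x)]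
  have key : ∀ ν : sphere (0 : Eucl n) 1, ‖∫ r : Ioi (0 : ℝ),
      Complex.exp (Complex.I * (2 * Real.pi * r.1 * inner ℝ ν.1 x : ℝ)) *
        (Complex.exp (Complex.I * (2 * Real.pi * (r.1 * t) : ℝ)) * φ (2 * Real.pi * h * r.1))
      ∂Measure.volumeIoiPow (n - 1)‖ ≤ C₀ * 2 ^ N * (h ^ n)⁻¹ * ((1 + |t| / h) ^ N)⁻¹ := fun ν => by
    rw [integral_volumeIoiPow (n - 1) fun r =>
      Complex.exp (Complex.I * (2 * Real.pi * r * inner ℝ ν.1 x : ℝ)) *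
        (Complex.exp (Complex.I * (2 * Real.pi * (r * t) : ℝ)) * φ (2 * Real.pi * h * r)),
      integral_radial_eq hsupp hn hh, norm_mul, Complex.norm_real,
      Real.norm_of_nonneg (by positivity)]
    have hu : |inner ℝ ν.1 x| ≤ ‖x‖ := by
      simpa [norm_eq_of_mem_sphere ν] using abs_real_inner_le_norm ν.1 x
    have h1 : (1 + |t| / h) / 2 ≤ 1 + |(inner ℝ ν.1 x + t) / h| := by
      rw [abs_div, abs_of_pos hh]
      have : |t| / 2 ≤ |inner ℝ ν.1 x + t| := by
        have := abs_sub_abs_le_abs_sub t (-(inner ℝ ν.1 x))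
        rw [abs_neg, sub_neg_eq_add, add_comm t] at this
        linarith
      have h2 : |t| / 2 / h ≤ |inner ℝ ν.1 x + t| / h := by gcongr
      have h3 : |t| / 2 / h = |t| / h / 2 := by ring
      linarith
    have h4 : ((1 + |t| / h) / 2) ^ N * ‖𝓕⁻ ψ ((inner ℝ ν.1 x + t) / h)‖ ≤ C₀ :=
      le_trans (by gcongr) (hdec ((inner ℝ ν.1 x + t) / h))
    have h5 : ‖𝓕⁻ ψ ((inner ℝ ν.1 x + t) / h)‖ ≤ C₀ * 2 ^ N * ((1 + |t| / h) ^ N)⁻¹ := by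
      have hp : 0 < (1 + |t| / h) ^ N := by positivity
      rw [← div_eq_mul_inv, le_div_iff₀ hp]
      rw [div_pow, div_mul_eq_mul_div, div_le_iff₀ (by positivity)] at h4
      linarith
    calc (h ^ n)⁻¹ * ‖𝓕⁻ ψ ((inner ℝ ν.1 x + t) / h)‖
        ≤ (h ^ n)⁻¹ * (C₀ * 2 ^ N * ((1 + |t| / h) ^ N)⁻¹) := by gcongr
      _ = _ := by ring
  refine (norm_integral_le_of_norm_le_const (Filter.Eventually.of_forall key)).trans ?_
  have hq : 0 ≤ (h ^ n)⁻¹ * ((1 + |t| / h) ^ N)⁻¹ := by positivity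
  nlinarith

theorem profile_eq_zero (hsupp : tsupport φ ⊆ Ioi 0) {b h : ℝ} (hb : ∀ r, b < r → φ r = 0)
    (hh : 0 < h) (e : Eucl n) (ρ : ℝ) {r : ℝ} (hr : r ∉ Ioc 0 (b / (2 * Real.pi * h))) :
    profile n φ h e ρ r = 0 := by
  have : φ (2 * Real.pi * h * r) = 0 := by
    rcases le_or_gt r 0 with h0 | h0
    · exact eq_zero_of_nonpos hsupp (mul_nonpos_of_nonneg_of_nonpos (by positivity) h0)
    · refine hb _ ?_
      have h1 : b / (2 * Real.pi * h) < r := by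
        by_contra h2
        exact hr ⟨h0, not_lt.1 h2⟩
      rw [div_lt_iff₀ (by positivity)] at h1
      linarith
  rw [profile, this]; simp

theorem continuous_profile (hφ : Continuous φ) (h : ℝ) {e : Eucl n} (he : ‖e‖ = 1) (ρ : ℝ) :
    Continuous (profile n φ h e ρ) := by
  have h0 : Continuous (sphereMoment e 0) :=
    continuous_iff_continuousAt.2 fun r => (hasDerivAt_sphereMoment he 0 r).continuousAt
  unfold profile
  have := h0.comp (by fun_prop : Continuous fun r : ℝ => 2 * Real.pi * r * ρ)
  exact (by fun_prop : Continuous fun r : ℝ => ((r ^ (n - 1) : ℝ) : ℂ) *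
    φ (2 * Real.pi * h * r)).mul this

/-- Split r^{n-1} as rᵃ·rᵃ with a = (n-1)/2. The decay of the sphere integral at 2πrρ cancels one
factor and leaves ρ^{-a}; the other is O(h^{-a}), because φ forces r ≤ b/(2πh). -/
theorem exists_norm_profile_le [NeZero n] (hφ : Continuous φ) (hc : HasCompactSupport φ)
    (hsupp : tsupport φ ⊆ Ioi 0) :
    ∃ C : ℝ, 0 < C ∧ ∀ (h ρ r : ℝ) (e : Eucl n), 0 < h → 0 < ρ → ‖e‖ = 1 →
      ‖profile n φ h e ρ r‖ ≤ C * h ^ (-(((n : ℝ) - 1) / 2)) * ρ ^ (-(((n : ℝ) - 1) / 2)) := by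
  obtain ⟨b, hb0, hb⟩ := exists_forall_lt_eq_zero hc
  obtain ⟨M, hM⟩ := hφ.bounded_above_of_compact_support hc
  have hM0 : 0 ≤ M := (norm_nonneg _).trans (hM 0)
  obtain ⟨C, hC0, hC⟩ := exists_norm_sphereMoment_le (E := Eucl n)
  rw [finrank_euclideanSpace_fin] at hC
  set a : ℝ := ((n : ℝ) - 1) / 2 with ha
  have hn : 1 ≤ n := Nat.one_le_iff_ne_zero.2 (NeZero.ne n)
  have ha0 : 0 ≤ a := by
    have : (1 : ℝ) ≤ n := by exact_mod_cast hn
    rw [ha]; linarith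
  refine ⟨M * C * (2 * Real.pi) ^ (-a) * (b / (2 * Real.pi)) ^ a + 1, by positivity,
    fun h ρ r e hh hρ he => ?_⟩
  have hpos : 0 ≤ h ^ (-a) * ρ ^ (-a) := by positivity
  by_cases hr : r ∈ Ioc 0 (b / (2 * Real.pi * h))
  · have hr0 : 0 < r := hr.1
    have h1 : r ^ (n - 1) = r ^ a * r ^ a := by
      rw [← Real.rpow_add hr0, ← Real.rpow_natCast]
      congr 1
      rw [ha]; push_cast [Nat.cast_sub hn]; ring
    have h2 : (2 * Real.pi * r * ρ) ^ (-a) = (2 * Real.pi) ^ (-a) * (r ^ a)⁻¹ * ρ ^ (-a) := by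
      rw [Real.mul_rpow (by positivity) hρ.le, Real.mul_rpow (by positivity) hr0.le,
        Real.rpow_neg hr0.le]
    have h3 : r ^ a ≤ (b / (2 * Real.pi)) ^ a * h ^ (-a) := by
      rw [Real.rpow_neg hh.le, ← Real.inv_rpow hh.le, ← Real.mul_rpow (by positivity) (by positivity)]
      refine Real.rpow_le_rpow hr0.le (hr.2.trans_eq ?_) ha0
      field_simp
    have hra : 0 < r ^ a := by positivity
    calc ‖profile n φ h e ρ r‖ = r ^ (n - 1) * ‖φ (2 * Real.pi * h * r)‖ *
          ‖sphereMoment e 0 (2 * Real.pi * r * ρ)‖ := by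
          rw [profile, norm_mul, norm_mul, Complex.norm_real, Real.norm_of_nonneg (by positivity)]
      _ ≤ r ^ (n - 1) * M * (C * (2 * Real.pi * r * ρ) ^ (-a)) := by
          gcongr
          · exact hM _
          · exact hC e _ he (by positivity)
      _ = M * C * (2 * Real.pi) ^ (-a) * r ^ a * ρ ^ (-a) := by
          rw [h1, h2]; field_simp
      _ ≤ M * C * (2 * Real.pi) ^ (-a) * ((b / (2 * Real.pi)) ^ a * h ^ (-a)) * ρ ^ (-a) := by
          gcongr
      _ ≤ _ := by nlinarith
  · rw [profile_eq_zero hsupp hb hh e ρ hr, norm_zero]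
    positivity

end Kernel

/-! ### Pointwise and square-integral bounds for the kernel -/

section KernelBounds

open Metric Set

variable {n : ℕ} {φ : ℝ → ℂ}

theorem eLpNorm_two_sq {α : Type*} [MeasurableSpace α] {μ : Measure α} (f : α → ℂ) :
    eLpNorm f 2 μ ^ 2 = ∫⁻ x, ‖f x‖ₑ ^ 2 ∂μ := by
  have := eLpNorm_nnreal_pow_eq_lintegral (μ := μ) (f := f) (p := 2) (by norm_num)
  simpa only [NNReal.coe_ofNat, ENNReal.coe_ofNat, ENNReal.rpow_ofNat] using this

/-- The kernel is at most the L¹ norm of the profile, that is, its supremum times the length b/(2πh)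
of its support. The length supplies the extra power h⁻¹. -/
theorem exists_norm_kernel_le_norm_rpow [NeZero n] (hφ : Continuous φ) (hc : HasCompactSupport φ)
    (hsupp : tsupport φ ⊆ Ioi 0) :
    ∃ C : ℝ, 0 < C ∧ ∀ (h t : ℝ) (x : Eucl n), 0 < h → x ≠ 0 →
      ‖kernel n φ t h x‖ ≤ C * h ^ (-(((n : ℝ) + 1) / 2)) * ‖x‖ ^ (-(((n : ℝ) - 1) / 2)) := by
  obtain ⟨b, hb0, hb⟩ := exists_forall_lt_eq_zero hc
  obtain ⟨C, hC0, hC⟩ := exists_norm_profile_le (n := n) hφ hc hsupp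
  refine ⟨C * (b / (2 * Real.pi)), by positivity, fun h t x hh hx => ?_⟩
  have hx0 : 0 < ‖x‖ := norm_pos_iff.2 hx
  have he : ‖‖x‖⁻¹ • x‖ = 1 := norm_smul_inv_norm hx
  have e1 : x = ‖x‖ • (‖x‖⁻¹ • x) := by rw [smul_smul, mul_inv_cancel₀ hx0.ne', one_smul]
  set e := ‖x‖⁻¹ • x
  conv_lhs => rw [e1]
  rw [kernel_eq_fourierInv_profile hφ hc hsupp hh, Real.fourierInv_eq]
  refine (norm_integral_le_integral_norm _).trans ?_
  simp only [Circle.norm_smul]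
  set R := b / (2 * Real.pi * h) with hR
  set B := C * h ^ (-(((n : ℝ) - 1) / 2)) * ‖x‖ ^ (-(((n : ℝ) - 1) / 2)) with hB
  rw [← setIntegral_eq_integral_of_forall_compl_eq_zero (s := Ioc 0 R) fun r hr => by
    rw [profile_eq_zero hsupp hb hh e _ hr, norm_zero]]
  have h1 : ‖∫ r in Ioc 0 R, ‖profile n φ h e ‖x‖ r‖‖ ≤ B * volume.real (Ioc 0 R) :=
    norm_setIntegral_le_of_norm_le_const (by simp) fun r _ => by
      rw [norm_norm]; exact hC h ‖x‖ r e hh hx0 he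
  refine (le_abs_self _).trans (h1.trans_eq ?_)
  rw [Real.volume_real_Ioc_of_le (by positivity), hB, sub_zero, hR]
  have : h ^ (-(((n : ℝ) + 1) / 2)) = h ^ (-(((n : ℝ) - 1) / 2)) * h⁻¹ := by
    rw [← Real.rpow_neg_one, ← Real.rpow_add hh]; congr 1; ring
  rw [this]
  field_simp

/-- The dispersive estimate for the kernel. -/
theorem exists_norm_kernel_le [NeZero n] (hφ : ContDiff ℝ ∞ φ) (hc : HasCompactSupport φ)
    (hsupp : tsupport φ ⊆ Ioi 0) :
    ∃ C : ℝ, 0 < C ∧ ∀ (h t : ℝ) (x : Eucl n), 0 < h → t ≠ 0 →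
      ‖kernel n φ t h x‖ ≤ C * h ^ (-(((n : ℝ) + 1) / 2)) * |t| ^ (-(((n : ℝ) - 1) / 2)) := by
  obtain ⟨C₁, hC₁0, hC₁⟩ := exists_norm_kernel_le_norm_rpow (n := n) hφ.continuous hc hsupp
  obtain ⟨C₂, hC₂0, hC₂⟩ := exists_kernel_decay (n := n) hφ hc hsupp n
  have hn : (1 : ℝ) ≤ n := by exact_mod_cast Nat.one_le_iff_ne_zero.2 (NeZero.ne n)
  set a : ℝ := ((n : ℝ) - 1) / 2 with ha
  have ha0 : 0 ≤ a := by rw [ha]; linarith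
  refine ⟨C₁ * 2 ^ a + C₂, by positivity, fun h t x hh ht => ?_⟩
  have ht0 : 0 < |t| := abs_pos.2 ht
  -- Off the cone the rapid decay of order n is more than enough, as a ≤ n. Otherwise ‖x‖ > |t|/2,
  -- and decay in x is decay in t.
  rcases le_or_gt (2 * ‖x‖) |t| with hx | hx
  · refine (hC₂ h t x hh hx).trans ?_
    have h1 : ((1 + |t| / h) ^ n)⁻¹ ≤ (|t| / h) ^ (-a) := by
      rw [Real.rpow_neg (by positivity)]
      refine inv_anti₀ (by positivity) ?_
      calc (|t| / h) ^ a ≤ (1 + |t| / h) ^ a :=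
            Real.rpow_le_rpow (by positivity) (by linarith) ha0
        _ ≤ (1 + |t| / h) ^ (n : ℝ) := Real.rpow_le_rpow_of_exponent_le
            (by have : 0 ≤ |t| / h := by positivity
                linarith) (by rw [ha]; linarith)
        _ = _ := Real.rpow_natCast _ _
    have h2 : (h ^ n)⁻¹ * (|t| / h) ^ (-a) = h ^ (-(((n : ℝ) + 1) / 2)) * |t| ^ (-a) := by
      rw [Real.div_rpow ht0.le hh.le, Real.rpow_neg hh.le a, div_inv_eq_mul, ← Real.rpow_natCast,
        ← Real.rpow_neg hh.le]
      have : h ^ (-(((n : ℝ) + 1) / 2)) = h ^ (-(n : ℝ)) * h ^ a := by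
        rw [← Real.rpow_add hh]; congr 1; rw [ha]; ring
      rw [this]; ring
    calc C₂ * (h ^ n)⁻¹ * ((1 + |t| / h) ^ n)⁻¹ ≤ C₂ * (h ^ n)⁻¹ * (|t| / h) ^ (-a) := by gcongr
      _ = C₂ * (h ^ (-(((n : ℝ) + 1) / 2)) * |t| ^ (-a)) := by rw [mul_assoc, h2]
      _ ≤ (C₁ * 2 ^ a + C₂) * (h ^ (-(((n : ℝ) + 1) / 2)) * |t| ^ (-a)) := by
          gcongr
          exact le_add_of_nonneg_left (by positivity)
      _ = _ := by ring
  · have hx0 : 0 < ‖x‖ := by linarith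
    refine (hC₁ h t x hh (norm_pos_iff.1 hx0)).trans ?_
    have h1 : ‖x‖ ^ (-a) ≤ 2 ^ a * |t| ^ (-a) := by
      have : ‖x‖ ^ (-a) ≤ (|t| / 2) ^ (-a) :=
        Real.rpow_le_rpow_of_nonpos (by positivity) (by linarith) (by linarith)
      refine this.trans_eq ?_
      rw [Real.div_rpow ht0.le zero_le_two, Real.rpow_neg zero_le_two, div_inv_eq_mul, mul_comm]
    calc C₁ * h ^ (-(((n : ℝ) + 1) / 2)) * ‖x‖ ^ (-a)
        ≤ C₁ * h ^ (-(((n : ℝ) + 1) / 2)) * (2 ^ a * |t| ^ (-a)) := by gcongr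
      _ = C₁ * 2 ^ a * (h ^ (-(((n : ℝ) + 1) / 2)) * |t| ^ (-a)) := by ring
      _ ≤ (C₁ * 2 ^ a + C₂) * (h ^ (-(((n : ℝ) + 1) / 2)) * |t| ^ (-a)) := by
          gcongr
          exact le_add_of_nonneg_right hC₂0.le
      _ = _ := by ring

/-- Plancherel in t: the integral equals the squared L² norm of the profile, at most its squared
supremum times the length of its support. -/
theorem exists_lintegral_time_kernel_le [NeZero n] (hφ : Continuous φ) (hc : HasCompactSupport φ)
    (hsupp : tsupport φ ⊆ Ioi 0) :
    ∃ C : ℝ, 0 < C ∧ ∀ (h : ℝ) (x : Eucl n), 0 < h → x ≠ 0 →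
      ∫⁻ t, ‖kernel n φ t h x‖ₑ ^ 2 ≤
        ENNReal.ofReal (C * h ^ (-(n : ℝ)) * ‖x‖ ^ (-((n : ℝ) - 1))) := by
  obtain ⟨b, hb0, hb⟩ := exists_forall_lt_eq_zero hc
  obtain ⟨C, hC0, hC⟩ := exists_norm_profile_le (n := n) hφ hc hsupp
  refine ⟨C ^ 2 * (b / (2 * Real.pi)), by positivity, fun h x hh hx => ?_⟩
  have hx0 : 0 < ‖x‖ := norm_pos_iff.2 hx
  have he : ‖‖x‖⁻¹ • x‖ = 1 := norm_smul_inv_norm hx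
  have e1 : x = ‖x‖ • (‖x‖⁻¹ • x) := by rw [smul_smul, mul_inv_cancel₀ hx0.ne', one_smul]
  set e := ‖x‖⁻¹ • x
  conv_lhs => rw [e1]
  simp only [kernel_eq_fourierInv_profile hφ hc hsupp hh]
  set R := b / (2 * Real.pi * h) with hR
  set B := C * h ^ (-(((n : ℝ) - 1) / 2)) * ‖x‖ ^ (-(((n : ℝ) - 1) / 2)) with hB
  have hcs : HasCompactSupport (profile n φ h e ‖x‖) :=
    HasCompactSupport.of_support_subset_isCompact (isCompact_Icc (a := 0) (b := R)) fun r hr => by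
      by_contra h'
      exact hr (profile_eq_zero hsupp hb hh e _ fun h'' => h' ⟨h''.1.le, h''.2⟩)
  have hpc := continuous_profile (n := n) hφ h he ‖x‖
  rw [← eLpNorm_two_sq, eLpNorm_fourierInv_eq (hpc.memLp_of_hasCompactSupport hcs)
    (hpc.memLp_of_hasCompactSupport hcs), eLpNorm_two_sq]
  have h1 : ∀ r, ‖profile n φ h e ‖x‖ r‖ₑ ^ 2 ≤ (Ioc 0 R).indicator
      (fun _ => ENNReal.ofReal (B ^ 2)) r := fun r => by
    by_cases hr : r ∈ Ioc 0 R
    · rw [indicator_of_mem hr, ← ofReal_norm, ← ENNReal.ofReal_pow (norm_nonneg _)]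
      refine ENNReal.ofReal_le_ofReal (pow_le_pow_left₀ (norm_nonneg _) ?_ 2)
      exact hC h ‖x‖ r e hh hx0 he
    · rw [indicator_of_notMem hr, profile_eq_zero hsupp hb hh e _ hr]; simp
  refine (lintegral_mono h1).trans ?_
  rw [lintegral_indicator measurableSet_Ioc, setLIntegral_const, Real.volume_Ioc, sub_zero,
    ← ENNReal.ofReal_mul (by positivity)]
  refine ENNReal.ofReal_le_ofReal (le_of_eq ?_)
  have h2 : h ^ (-(n : ℝ)) = (h ^ (-(((n : ℝ) - 1) / 2))) ^ 2 * h⁻¹ := by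
    rw [← Real.rpow_natCast, ← Real.rpow_mul hh.le, ← Real.rpow_neg_one h, ← Real.rpow_add hh]
    congr 1; push_cast; ring
  have h3 : ‖x‖ ^ (-((n : ℝ) - 1)) = (‖x‖ ^ (-(((n : ℝ) - 1) / 2))) ^ 2 := by
    rw [← Real.rpow_natCast, ← Real.rpow_mul hx0.le]
    congr 1; push_cast; ring
  rw [h2, h3, hB, hR]
  field_simp

/-- Plancherel in x: the symbol is bounded and lives in a ball of radius O(1/h). -/
theorem exists_lintegral_space_kernel_le [NeZero n] (hφ : Continuous φ)
    (hc : HasCompactSupport φ) :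
    ∃ C : ℝ, 0 < C ∧ ∀ h t : ℝ, 0 < h →
      ∫⁻ x : Eucl n, ‖kernel n φ t h x‖ₑ ^ 2 ≤ ENNReal.ofReal (C * h ^ (-(n : ℝ))) := by
  obtain ⟨b, hb0, hb⟩ := exists_forall_lt_eq_zero hc
  obtain ⟨M, hM⟩ := hφ.bounded_above_of_compact_support hc
  have hM0 : 0 ≤ M := (norm_nonneg _).trans (hM 0)
  set V := volume.real (ball (0 : Eucl n) 1)
  have hV : 0 ≤ V := measureReal_nonneg
  refine ⟨M ^ 2 * (b / (2 * Real.pi)) ^ n * V + 1, by positivity, fun h t hh => ?_⟩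
  set R := b / (2 * Real.pi * h) with hR
  rw [← eLpNorm_two_sq, kernel, eLpNorm_fourierInv_eq (memLp_symbol_of_pos hφ hc hh t 1)
    (memLp_symbol_of_pos hφ hc hh t 2), eLpNorm_two_sq]
  have h1 : ∀ ξ : Eucl n, ‖symbol n φ t h ξ‖ₑ ^ 2 ≤ (closedBall 0 R).indicator
      (fun _ => ENNReal.ofReal (M ^ 2)) ξ := fun ξ => by
    by_cases hξ : ξ ∈ closedBall 0 R
    · rw [indicator_of_mem hξ, ← ofReal_norm, ← ENNReal.ofReal_pow (norm_nonneg _)]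
      refine ENNReal.ofReal_le_ofReal (pow_le_pow_left₀ (norm_nonneg _) ?_ 2)
      rw [norm_symbol]; exact hM _
    · rw [indicator_of_notMem hξ, symbol_eq_zero hb hh t (by simpa using hξ)]; simp
  refine (lintegral_mono h1).trans ?_
  have hR0 : 0 ≤ R := by positivity
  rw [lintegral_indicator measurableSet_closedBall, setLIntegral_const,
    Measure.addHaar_closedBall _ _ hR0, finrank_euclideanSpace_fin,
    ← ofReal_measureReal (measure_ball_lt_top).ne, ← ENNReal.ofReal_mul (by positivity),
    ← ENNReal.ofReal_mul (by positivity)]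
  refine ENNReal.ofReal_le_ofReal ?_
  have h2 : R ^ n = (b / (2 * Real.pi)) ^ n * h ^ (-(n : ℝ)) := by
    rw [Real.rpow_neg hh.le, Real.rpow_natCast, ← inv_pow, ← mul_pow, hR]
    congr 1; field_simp
  rw [h2]
  have : 0 ≤ h ^ (-(n : ℝ)) := by positivity
  nlinarith

theorem lintegral_inv_one_add_div_sq {h : ℝ} (hh : 0 < h) :
    ∫⁻ t : ℝ, ENNReal.ofReal ((1 + (t / h) ^ 2)⁻¹) = ENNReal.ofReal (h * Real.pi) := by
  rw [← ofReal_integral_eq_lintegral_ofReal]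
  · rw [Measure.integral_comp_div (fun t : ℝ => (1 + t ^ 2)⁻¹), integral_univ_inv_one_add_sq,
      abs_of_pos hh, smul_eq_mul]
  · exact integrable_inv_one_add_sq.comp_div hh.ne'
  · exact Filter.Eventually.of_forall fun t => by positivity

/-- For |t| < 2‖x‖ the weight is at most (2‖x‖)^{2s} and the unweighted bound applies. The remaining
times lie off the light cone, where rapid decay makes the weighted integral converge. -/
theorem exists_lintegral_weighted_time_kernel_le [NeZero n] (hφ : ContDiff ℝ ∞ φ)
    (hc : HasCompactSupport φ) (hsupp : tsupport φ ⊆ Ioi 0) {s : ℝ} (hs0 : 0 ≤ s)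
    (hs : s ≤ ((n : ℝ) - 1) / 2) :
    ∃ C : ℝ, 0 < C ∧ ∀ (h : ℝ) (x : Eucl n), 0 < h → x ≠ 0 →
      ∫⁻ t, ENNReal.ofReal (|t| ^ (2 * s)) * ‖kernel n φ t h x‖ₑ ^ 2 ≤
        ENNReal.ofReal (C * h ^ (-(n : ℝ)) * ‖x‖ ^ (2 * s - ((n : ℝ) - 1))) := by
  obtain ⟨C₁, hC₁0, hC₁⟩ := exists_lintegral_time_kernel_le (n := n) hφ.continuous hc hsupp
  obtain ⟨C₂, hC₂0, hC₂⟩ := exists_kernel_decay (n := n) hφ hc hsupp n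
  have hn : 1 ≤ n := Nat.one_le_iff_ne_zero.2 (NeZero.ne n)
  set q : ℝ := 2 * s - ((n : ℝ) - 1) with hq
  have hq0 : q ≤ 0 := by rw [hq]; linarith
  refine ⟨2 ^ (2 * s) * C₁ + C₂ ^ 2 * Real.pi, by positivity, fun h x hh hx => ?_⟩
  have hx0 : 0 < ‖x‖ := norm_pos_iff.2 hx
  have hpt : ∀ t : ℝ, ENNReal.ofReal (|t| ^ (2 * s)) * ‖kernel n φ t h x‖ₑ ^ 2 ≤
      ENNReal.ofReal ((2 * ‖x‖) ^ (2 * s)) * ‖kernel n φ t h x‖ₑ ^ 2 +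
      ENNReal.ofReal (C₂ ^ 2 * ‖x‖ ^ q * h ^ (-(n : ℝ)) * h⁻¹) *
        ENNReal.ofReal ((1 + (t / h) ^ 2)⁻¹) := fun t => by
    rcases le_or_gt (2 * ‖x‖) |t| with ht | ht
    · refine le_trans ?_ le_add_self
      have ht0 : 0 < |t| := by linarith
      rw [← ofReal_norm, ← ENNReal.ofReal_pow (norm_nonneg _),
        ← ENNReal.ofReal_mul (by positivity), ← ENNReal.ofReal_mul (by positivity)]
      refine ENNReal.ofReal_le_ofReal ?_
      set z := |t| / h with hz
      have hz0 : 0 ≤ z := by positivity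
      have h1 : |t| ^ (2 * s) ≤ ‖x‖ ^ q * (h ^ (n - 1) * (1 + z) ^ (n - 1)) := by
        -- As q ≤ 0 and |t| ≥ ‖x‖, the first factor is at most ‖x‖^q. The other n - 1 powers of |t|
        -- are absorbed by the decay of the kernel.
        have e1 : |t| ^ (2 * s) = |t| ^ q * |t| ^ (n - 1) := by
          rw [← Real.rpow_natCast, ← Real.rpow_add ht0]
          congr 1; push_cast [Nat.cast_sub hn]; rw [hq]; ring
        have e2 : |t| = h * z := by rw [hz]; field_simp
        have e3 : |t| ^ q ≤ ‖x‖ ^ q := Real.rpow_le_rpow_of_nonpos hx0 (by linarith) hq0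
        have e4 : |t| ^ (n - 1) ≤ h ^ (n - 1) * (1 + z) ^ (n - 1) := by
          rw [← mul_pow]
          refine pow_le_pow_left₀ ht0.le ?_ _
          rw [e2]; gcongr; linarith
        rw [e1]; gcongr
      have h2 : ‖kernel n φ t h x‖ ^ 2 ≤ (C₂ * (h ^ n)⁻¹ * ((1 + z) ^ n)⁻¹) ^ 2 := by
        gcongr; exact hC₂ h t x hh ht
      have h3 : (1 + z) ^ (n - 1) * (((1 + z) ^ n)⁻¹) ^ 2 ≤ (1 + (t / h) ^ 2)⁻¹ := by
        -- The surviving decay has order n + 1 ≥ 2, hence is integrable in t. Its integral is at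
        -- most hπ, which turns h⁻ⁿ·h⁻¹ into h⁻ⁿ.
        have e5 : (1 + z) ^ (n - 1) * (((1 + z) ^ n)⁻¹) ^ 2 = ((1 + z) ^ (n + 1))⁻¹ := by
          have : (1 + z) ^ n = (1 + z) ^ (n - 1) * (1 + z) := by
            rw [← pow_succ, Nat.sub_add_cancel hn]
          rw [pow_succ (1 + z) n, this]
          field_simp
        rw [e5]
        refine inv_anti₀ (by positivity) ?_
        have e6 : (t / h) ^ 2 = z ^ 2 := by rw [hz, div_pow, div_pow, sq_abs]
        rw [e6]
        calc 1 + z ^ 2 ≤ (1 + z) ^ 2 := by nlinarith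
          _ ≤ (1 + z) ^ (n + 1) := pow_le_pow_right₀ (by linarith) (by omega)
      have h4 : h ^ (-(n : ℝ)) * h⁻¹ = h ^ (n - 1) * ((h ^ n)⁻¹) ^ 2 := by
        have : h ^ n = h ^ (n - 1) * h := by rw [← pow_succ, Nat.sub_add_cancel hn]
        rw [Real.rpow_neg hh.le, Real.rpow_natCast, this]
        field_simp
      calc |t| ^ (2 * s) * ‖kernel n φ t h x‖ ^ 2
          ≤ (‖x‖ ^ q * (h ^ (n - 1) * (1 + z) ^ (n - 1))) *
            (C₂ * (h ^ n)⁻¹ * ((1 + z) ^ n)⁻¹) ^ 2 := by gcongr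
        _ = C₂ ^ 2 * ‖x‖ ^ q * (h ^ (n - 1) * ((h ^ n)⁻¹) ^ 2) *
            ((1 + z) ^ (n - 1) * (((1 + z) ^ n)⁻¹) ^ 2) := by ring
        _ ≤ C₂ ^ 2 * ‖x‖ ^ q * (h ^ (n - 1) * ((h ^ n)⁻¹) ^ 2) * (1 + (t / h) ^ 2)⁻¹ := by gcongr
        _ = _ := by rw [← h4]; ring
    · refine le_trans ?_ le_self_add
      gcongr
  refine (lintegral_mono hpt).trans ?_
  rw [lintegral_add_right _ (by fun_prop), lintegral_const_mul' _ _ ENNReal.ofReal_ne_top,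
    lintegral_const_mul' _ _ ENNReal.ofReal_ne_top, lintegral_inv_one_add_div_sq hh,
    ← ENNReal.ofReal_mul (by positivity)]
  refine (add_le_add_left (mul_le_mul_right (hC₁ h x hh hx) _) _).trans ?_
  rw [← ENNReal.ofReal_mul (by positivity), ← ENNReal.ofReal_add (by positivity) (by positivity)]
  refine ENNReal.ofReal_le_ofReal (le_of_eq ?_)
  have e7 : ‖x‖ ^ q = ‖x‖ ^ (2 * s) * ‖x‖ ^ (-((n : ℝ) - 1)) := by
    rw [← Real.rpow_add hx0]; congr 1
  rw [Real.mul_rpow zero_le_two hx0.le, e7]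
  field_simp

end KernelBounds

/-! ### Integrals of powers of ⟨x⟩ and |x| -/

section Bracket

open Metric Set

theorem bracket_pos {V : Type*} [NormedAddCommGroup V] (x : V) : 0 < bracket x :=
  one_pos.trans_le (one_le_bracket x)

theorem bracket_rpow {V : Type*} [NormedAddCommGroup V] (x : V) (a : ℝ) :
    bracket x ^ a = (1 + ‖x‖ ^ 2) ^ (a / 2) := by
  rw [bracket, Real.sqrt_eq_rpow, ← Real.rpow_mul (by positivity)]
  congr 1; ring

theorem continuous_bracket_rpow {V : Type*} [NormedAddCommGroup V] (a : ℝ) :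
    Continuous fun x : V => bracket x ^ a := by
  refine Continuous.rpow_const ?_ fun x => Or.inl (bracket_pos x).ne'
  unfold bracket; fun_prop

theorem bracket_le_one_add_abs (t : ℝ) : bracket t ≤ 1 + |t| := by
  rw [bracket, Real.sqrt_le_left (by positivity), Real.norm_eq_abs]
  nlinarith [abs_nonneg t]

variable {n : ℕ}

theorem integrable_bracket_rpow {r : ℝ} (hr : (n : ℝ) < r) :
    Integrable fun x : Eucl n => bracket x ^ (-r) := by
  simp only [bracket_rpow]
  exact integrable_rpow_neg_one_add_norm_sq (by simpa using hr)

/-- In polar coordinates the radial density y^{n-1+q} is at most 1 on (0, 1). The stronger condition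
q ≥ -(n-1), instead of q > -n, is what makes it bounded. -/
theorem integrableOn_ball_norm_rpow {q : ℝ} (hn : 1 ≤ n) (hq : -((n : ℝ) - 1) ≤ q) :
    IntegrableOn (fun x : Eucl n => ‖x‖ ^ q) (ball 0 1) := by
  have : NeZero n := ⟨by omega⟩
  rw [integrableOn_fun_norm_addHaar (E := Eucl n) (μ := volume) (f := fun y : ℝ => y ^ q),
    finrank_euclideanSpace_fin]
  refine Measure.integrableOn_of_bounded (M := 1) (by simp) (Measurable.aestronglyMeasurable
    (by simp only [smul_eq_mul]; fun_prop)) ?_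
  filter_upwards [ae_restrict_mem measurableSet_Ioo] with y hy
  have hy0 : 0 < y := hy.1
  rw [smul_eq_mul, ← Real.rpow_natCast, ← Real.rpow_add hy0, Real.norm_of_nonneg (by positivity)]
  refine Real.rpow_le_one hy0.le hy.2.le ?_
  push_cast [Nat.cast_sub hn]
  linarith

/-- A uniform bound for the convolution of `⟨x⟩^{-w}` with `|x|^q`. -/
theorem exists_lintegral_bracket_mul_norm_rpow_le (hn : 1 ≤ n) {w q : ℝ} (hq0 : q ≤ 0)
    (hq : -((n : ℝ) - 1) ≤ q) (hwq : (n : ℝ) < w - q) :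
    ∃ C : ℝ, 0 < C ∧ ∀ y : Eucl n,
      ∫⁻ x : Eucl n, ENNReal.ofReal (bracket x ^ (-w)) * ENNReal.ofReal (‖x - y‖ ^ q) ≤
        ENNReal.ofReal C := by
  -- F carries the singularity of |x - y|^q near x = y, where the weight is at most 1. G carries the
  -- region |x - y| ≥ 1, where |z|^q is comparable to ⟨z⟩^q. The integrals of F and G are
  -- translation invariant, hence the uniformity in y.
  set F : Eucl n → ℝ := fun z => (ball 0 1).indicator (fun z => ‖z‖ ^ q) z
  set G : Eucl n → ℝ := fun z => 2 ^ (-q / 2) * bracket z ^ (-(w - q))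
  have iF : Integrable F := (integrableOn_ball_norm_rpow hn hq).integrable_indicator
    measurableSet_ball
  have iG : Integrable G := (integrable_bracket_rpow hwq).const_mul _
  have F0 : ∀ z, 0 ≤ F z := fun z => indicator_nonneg (fun z _ => by positivity) z
  have G0 : ∀ z, 0 ≤ G z := fun z => mul_nonneg (by positivity) (Real.rpow_nonneg (bracket_pos z).le _)
  refine ⟨(∫ z, F z) + ((∫ z, G z) + ∫ z, G z) + 1, ?_, fun y => ?_⟩
  · have h1 : 0 ≤ ∫ z, F z := integral_nonneg F0
    have h2 : 0 ≤ ∫ z, G z := integral_nonneg G0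
    linarith
  have hpt : ∀ x, ENNReal.ofReal (bracket x ^ (-w)) * ENNReal.ofReal (‖x - y‖ ^ q) ≤
      ENNReal.ofReal (F (x - y)) + (ENNReal.ofReal (G x) + ENNReal.ofReal (G (x - y))) := fun x => by
    rw [← ENNReal.ofReal_add (G0 _) (G0 _), ← ENNReal.ofReal_add (F0 _) (add_nonneg (G0 _) (G0 _)),
      ← ENNReal.ofReal_mul (Real.rpow_nonneg (bracket_pos x).le _)]
    refine ENNReal.ofReal_le_ofReal ?_
    set z := x - y
    have hx1 := one_le_bracket x
    have hz1 := one_le_bracket z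
    have hx0 := bracket_pos x
    have hz0 := bracket_pos z
    rcases lt_or_ge ‖z‖ 1 with hz | hz
    · have h1 : F z = ‖z‖ ^ q := indicator_of_mem (by simpa using hz) _
      have h2 : bracket x ^ (-w) ≤ 1 := Real.rpow_le_one_of_one_le_of_nonpos hx1 (by linarith)
      have h3 : 0 ≤ ‖z‖ ^ q := by positivity
      have := G0 x
      have := G0 z
      rw [h1]
      nlinarith
    · have hzn : 0 < ‖z‖ := by linarith
      have h1 : ‖z‖ ^ q ≤ 2 ^ (-q / 2) * bracket z ^ q := by
        have e1 : ‖z‖ ^ q = (‖z‖ ^ 2) ^ (q / 2) := by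
          rw [← Real.rpow_natCast, ← Real.rpow_mul hzn.le]; congr 1; push_cast; ring
        have e2 : (2 : ℝ) ^ (-q / 2) * bracket z ^ q = ((1 + ‖z‖ ^ 2) / 2) ^ (q / 2) := by
          rw [bracket_rpow, Real.div_rpow (by positivity) zero_le_two, neg_div,
            Real.rpow_neg zero_le_two]
          field_simp
        rw [e1, e2]
        exact Real.rpow_le_rpow_of_nonpos (by positivity) (by nlinarith) (by linarith)
      -- Both exponents are nonpositive, so the product is at most the power -(w - q) of the smaller
      -- bracket.
      have h2 : bracket x ^ (-w) * bracket z ^ q ≤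
          bracket x ^ (-(w - q)) + bracket z ^ (-(w - q)) := by
        have px : bracket x ^ (-(w - q)) = bracket x ^ (-w) * bracket x ^ q := by
          rw [← Real.rpow_add hx0]; congr 1; ring
        have pz : bracket z ^ (-(w - q)) = bracket z ^ (-w) * bracket z ^ q := by
          rw [← Real.rpow_add hz0]; congr 1; ring
        have n1 : 0 ≤ bracket x ^ (-w) := by positivity
        have n2 : 0 ≤ bracket z ^ (-w) := by positivity
        have n3 : 0 ≤ bracket x ^ q := by positivity
        have n4 : 0 ≤ bracket z ^ q := by positivity
        rcases le_total (bracket x) (bracket z) with h | h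
        · have : bracket z ^ q ≤ bracket x ^ q := Real.rpow_le_rpow_of_nonpos hx0 h hq0
          rw [px, pz]; nlinarith [mul_nonneg n2 n4]
        · have : bracket x ^ (-w) ≤ bracket z ^ (-w) :=
            Real.rpow_le_rpow_of_nonpos hz0 h (by linarith)
          rw [px, pz]; nlinarith [mul_nonneg n1 n3]
      calc bracket x ^ (-w) * ‖z‖ ^ q ≤ bracket x ^ (-w) * (2 ^ (-q / 2) * bracket z ^ q) := by gcongr
        _ = 2 ^ (-q / 2) * (bracket x ^ (-w) * bracket z ^ q) := by ring
        _ ≤ 2 ^ (-q / 2) * (bracket x ^ (-(w - q)) + bracket z ^ (-(w - q))) := by gcongr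
        _ = G x + G z := by simp only [G]; ring
        _ ≤ F z + (G x + G z) := le_add_of_nonneg_left (F0 z)
  refine (lintegral_mono hpt).trans ?_
  have hGm : Measurable G := ((continuous_bracket_rpow _).measurable.const_mul _)
  rw [lintegral_add_right _ (by fun_prop), lintegral_add_left (by fun_prop),
    lintegral_sub_right_eq_self (fun z => ENNReal.ofReal (F z)) y,
    lintegral_sub_right_eq_self (fun z => ENNReal.ofReal (G z)) y,
    ← ofReal_integral_eq_lintegral_ofReal iF (Filter.Eventually.of_forall F0),
    ← ofReal_integral_eq_lintegral_ofReal iG (Filter.Eventually.of_forall G0),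
    ← ENNReal.ofReal_add (integral_nonneg G0) (integral_nonneg G0),
    ← ENNReal.ofReal_add (integral_nonneg F0) (add_nonneg (integral_nonneg G0) (integral_nonneg G0))]
  exact ENNReal.ofReal_le_ofReal (by linarith)

end Bracket

/-! ### Cauchy–Schwarz and elementary L² operator bounds -/

section Operators

open Metric Set

variable {n : ℕ} {φ : ℝ → ℂ}

theorem sq_lintegral_mul_le {α : Type*} [MeasurableSpace α] {μ : Measure α} {f g : α → ℝ≥0∞}
    (hf : AEMeasurable f μ) (hg : AEMeasurable g μ) :
    (∫⁻ x, f x * g x ∂μ) ^ 2 ≤ (∫⁻ x, f x ^ 2 ∂μ) * ∫⁻ x, g x ^ 2 ∂μ := by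
  have h := ENNReal.lintegral_mul_le_Lp_mul_Lq μ Real.HolderConjugate.two_two hf hg
  have h2 := pow_le_pow_left' h 2
  refine h2.trans_eq ?_
  simp only [ENNReal.rpow_ofNat]
  rw [mul_pow, ← ENNReal.rpow_mul_natCast, ← ENNReal.rpow_mul_natCast]
  norm_num

theorem norm_le_of_lintegral_sq_le {f g : LpR n 2} {c : ℝ} (hc : 0 ≤ c)
    (h : ∫⁻ x, ‖f x‖ₑ ^ 2 ≤ ENNReal.ofReal (c ^ 2) * ∫⁻ x, ‖g x‖ₑ ^ 2) : ‖f‖ ≤ c * ‖g‖ := by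
  rw [← eLpNorm_two_sq, ← eLpNorm_two_sq, ENNReal.ofReal_pow hc, ← mul_pow] at h
  have h1 := (ENNReal.pow_le_pow_left_iff (two_ne_zero)).1 h
  rw [Lp.norm_def, Lp.norm_def, ← ENNReal.toReal_ofReal hc, ← ENNReal.toReal_mul]
  exact ENNReal.toReal_mono (ENNReal.mul_ne_top ENNReal.ofReal_ne_top (Lp.eLpNorm_ne_top g)) h1

theorem norm_mulOp_le {m : Eucl n → ℂ} (hm : MemLp m ∞ volume) {B : ℝ} (hB : ∀ x, ‖m x‖ ≤ B)
    (f : LpR n 2) : ‖mulOp m hm f‖ ≤ B * ‖f‖ := by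
  refine Lp.norm_le_mul_norm_of_ae_le_mul ?_
  filter_upwards [mulOp_ae_eq hm f] with x hx
  rw [hx, norm_mul]
  gcongr
  exact hB x

theorem norm_wave_le (hφ : Continuous φ) (hc : HasCompactSupport φ) {M : ℝ} (hM : ∀ r, ‖φ r‖ ≤ M)
    (t h : ℝ) (f : LpR n 2) : ‖wave n φ hφ hc t h f‖ ≤ M * ‖f‖ := by
  have h1 := norm_mulOp_le (memLp_symbol n (measurable_waveFun hφ t h) (bounded_waveFun hφ hc t h))
    (B := M) (fun ξ => by
      have := norm_symbol (φ := φ) t h ξ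
      rw [symbol] at this
      rw [this]; exact hM _) (Lp.fourierTransformₗᵢ (Eucl n) ℂ f)
  rw [LinearIsometryEquiv.norm_map] at h1
  refine le_trans (le_of_eq ?_) h1
  exact (Lp.fourierTransformₗᵢ (Eucl n) ℂ).symm.norm_map _

theorem norm_weight_le {a : ℝ} (ha : 0 ≤ a) (f : LpR n 2) : ‖weight n a ha f‖ ≤ ‖f‖ := by
  have := norm_mulOp_le (memLp_weight n ha) (B := 1) (fun x => by
    rw [Complex.norm_real, Real.norm_of_nonneg (Real.rpow_nonneg (bracket_pos x).le _)]
    exact Real.rpow_le_one_of_one_le_of_nonpos (one_le_bracket x) (by linarith)) f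
  simpa using! this

end Operators

/-! ### Weighted L² decay -/

section LocalDecay

open Metric Set

variable {n : ℕ} {φ : ℝ → ℂ}

theorem memLp_indicator_one {A : Set (Eucl n)} (hA : MeasurableSet A) :
    MemLp (A.indicator fun _ => (1 : ℂ)) ∞ (volume : Measure (Eucl n)) :=
  memLp_top_of_bound (measurable_const.indicator hA).aestronglyMeasurable 1
    (Filter.Eventually.of_forall fun x => by
      by_cases hx : x ∈ A <;> simp [hx])

/-- Multiplication by the indicator function of `A`. -/
def cutoff {A : Set (Eucl n)} (hA : MeasurableSet A) : LpR n 2 →L[ℂ] LpR n 2 :=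
  mulOp _ (memLp_indicator_one hA)

theorem cutoff_ae_eq {A : Set (Eucl n)} (hA : MeasurableSet A) (f : LpR n 2) :
    cutoff hA f =ᵐ[volume] A.indicator f := by
  filter_upwards [mulOp_ae_eq (memLp_indicator_one hA) f] with x hx
  rw [cutoff, hx]
  by_cases h : x ∈ A <;> simp [h]

theorem cutoff_add_cutoff_compl {A : Set (Eucl n)} (hA : MeasurableSet A) (f : LpR n 2) :
    cutoff hA f + cutoff hA.compl f = f := by
  refine Lp.ext ?_
  filter_upwards [Lp.coeFn_add (cutoff hA f) (cutoff hA.compl f), cutoff_ae_eq hA f,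
    cutoff_ae_eq hA.compl f] with x h1 h2 h3
  rw [h1, Pi.add_apply, h2, h3, ← Pi.add_apply, indicator_self_add_compl]

theorem norm_cutoff_le {A : Set (Eucl n)} (hA : MeasurableSet A) (f : LpR n 2) :
    ‖cutoff hA f‖ ≤ ‖f‖ := by
  refine Lp.norm_le_norm_of_ae_le ?_
  filter_upwards [cutoff_ae_eq hA f] with x hx
  rw [hx]; exact norm_indicator_le_norm_self _ _

theorem norm_cutoff_weight_le {A : Set (Eucl n)} (hA : MeasurableSet A) {a : ℝ} (ha : 0 ≤ a)
    (f : LpR n 2) : ‖cutoff hA (weight n a ha f)‖ ≤ ‖cutoff hA f‖ := by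
  refine Lp.norm_le_norm_of_ae_le ?_
  filter_upwards [cutoff_ae_eq hA f, cutoff_ae_eq hA (weight n a ha f),
    mulOp_ae_eq (memLp_weight n ha) f] with x h1 h2 h3
  rw [h1, h2]
  by_cases hx : x ∈ A
  · rw [indicator_of_mem hx, indicator_of_mem hx, weight, h3, norm_mul, Complex.norm_real,
      Real.norm_of_nonneg (Real.rpow_nonneg (bracket_pos x).le _)]
    exact mul_le_of_le_one_left (norm_nonneg _)
      (Real.rpow_le_one_of_one_le_of_nonpos (one_le_bracket x) (by linarith))
  · simp [hx]

/-- Where |x| ≥ |t|/4 one has ⟨t⟩ ≤ 4⟨x⟩, so the weight alone gives the time decay. -/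
theorem norm_cutoff_compl_ball_weight_le {a : ℝ} (ha : 0 ≤ a) (t : ℝ) (f : LpR n 2) :
    ‖cutoff (measurableSet_ball (x := (0 : Eucl n)) (ε := |t| / 4)).compl (weight n a ha f)‖ ≤
      4 ^ a * bracket t ^ (-a) * ‖f‖ := by
  refine Lp.norm_le_mul_norm_of_ae_le_mul ?_
  filter_upwards [cutoff_ae_eq (measurableSet_ball (x := (0 : Eucl n)) (ε := |t| / 4)).compl
    (weight n a ha f), mulOp_ae_eq (memLp_weight n ha) f] with x h1 h2
  rw [h1]
  have hb := bracket_pos t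
  by_cases hx : x ∈ (ball (0 : Eucl n) (|t| / 4))ᶜ
  · rw [indicator_of_mem hx, weight, h2, norm_mul, Complex.norm_real,
      Real.norm_of_nonneg (Real.rpow_nonneg (bracket_pos x).le _)]
    gcongr
    have h3 : |t| / 4 ≤ ‖x‖ := by simpa using hx
    have h4 : bracket t / 4 ≤ bracket x := by
      rw [bracket, bracket, div_le_iff₀ (by norm_num)]
      have : (4 : ℝ) = Real.sqrt 16 := by
        rw [show (16 : ℝ) = 4 ^ 2 by norm_num, Real.sqrt_sq (by norm_num)]
      rw [this, ← Real.sqrt_mul (by positivity)]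
      refine Real.sqrt_le_sqrt ?_
      rw [Real.norm_eq_abs]
      nlinarith [abs_nonneg t]
    refine (Real.rpow_le_rpow_of_nonpos (by positivity) h4 (by linarith)).trans_eq ?_
    rw [Real.div_rpow hb.le (by norm_num), Real.rpow_neg (by norm_num : (0 : ℝ) ≤ 4),
      div_inv_eq_mul, mul_comm]
  · rw [indicator_of_notMem hx, norm_zero]
    positivity

/-- Two points of the ball differ by at most 2R, so only the kernel on ‖z‖ ≤ 2R enters.
Cauchy–Schwarz on the input and integration of the output over the ball each contribute the square
root of its volume. -/
theorem norm_cutoff_wave_cutoff_le (hφ : Continuous φ) (hc : HasCompactSupport φ) {h t R κ : ℝ}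
    (hh : 0 < h) (hκ0 : 0 ≤ κ) (hκ : ∀ z : Eucl n, ‖z‖ ≤ 2 * R → ‖kernel n φ t h z‖ ≤ κ)
    (g : LpR n 2) :
    ‖cutoff (measurableSet_ball (x := (0 : Eucl n)) (ε := R)) (wave n φ hφ hc t h
      (cutoff (measurableSet_ball (x := (0 : Eucl n)) (ε := R)) g))‖ ≤
      κ * volume.real (ball (0 : Eucl n) R) * ‖g‖ := by
  set A := ball (0 : Eucl n) R with hA
  have hAm : MeasurableSet A := measurableSet_ball
  set D : ℝ≥0∞ := ENNReal.ofReal κ * ∫⁻ y in A, ‖g y‖ₑ with hD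
  have hgm : AEMeasurable (fun y => ‖g y‖ₑ) (volume : Measure (Eucl n)) :=
    (Lp.aestronglyMeasurable g).enorm
  refine norm_le_of_lintegral_sq_le (mul_nonneg hκ0 measureReal_nonneg) ?_
  have h1 : ∀ᵐ x, ‖cutoff hAm (wave n φ hφ hc t h (cutoff hAm g)) x‖ₑ ^ 2 ≤
      A.indicator (fun _ => D ^ 2) x := by
    filter_upwards [cutoff_ae_eq hAm (wave n φ hφ hc t h (cutoff hAm g)),
      wave_ae_eq hφ hc hh t (cutoff hAm g)] with x h2 h3
    rw [h2]
    by_cases hx : x ∈ A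
    · rw [indicator_of_mem hx, indicator_of_mem hx, h3]
      refine pow_le_pow_left' ?_ 2
      refine (enorm_integral_le_lintegral_enorm _).trans ?_
      rw [hD, ← lintegral_indicator hAm, ← lintegral_const_mul' _ _ ENNReal.ofReal_ne_top]
      refine lintegral_mono_ae ?_
      filter_upwards [cutoff_ae_eq hAm g] with y hy
      rw [hy, enorm_mul]
      by_cases hyA : y ∈ A
      · rw [indicator_of_mem hyA, indicator_of_mem hyA]
        gcongr
        rw [← ofReal_norm]
        refine ENNReal.ofReal_le_ofReal (hκ _ ?_)
        rw [hA, mem_ball_zero_iff] at hx hyA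
        linarith [norm_sub_le x y]
      · simp [hyA]
    · simp [hx]
  have hV : volume A ≠ ⊤ := measure_ball_lt_top.ne
  refine (lintegral_mono_ae h1).trans ?_
  rw [lintegral_indicator hAm, setLIntegral_const]
  have h4 : (∫⁻ y in A, ‖g y‖ₑ) ^ 2 ≤ (∫⁻ y, ‖g y‖ₑ ^ 2) * volume A := by
    have := sq_lintegral_mul_le (μ := volume.restrict A) (f := fun y => ‖g y‖ₑ)
      (g := fun _ => 1) hgm.restrict aemeasurable_const
    simp only [mul_one, one_pow, lintegral_const, one_mul, Measure.restrict_apply_univ] at this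
    exact this.trans (mul_le_mul_left (setLIntegral_le_lintegral _ _) _)
  rw [hD, mul_pow, mul_pow, ENNReal.ofReal_mul (by positivity), ENNReal.ofReal_pow hκ0,
    ENNReal.ofReal_pow measureReal_nonneg, ofReal_measureReal hV]
  calc ENNReal.ofReal κ ^ 2 * (∫⁻ y in A, ‖g y‖ₑ) ^ 2 * volume A
      ≤ ENNReal.ofReal κ ^ 2 * ((∫⁻ y, ‖g y‖ₑ ^ 2) * volume A) * volume A := by gcongr
    _ = _ := by ring

theorem exists_norm_weight_wave_weight_le [NeZero n] (hφ : ContDiff ℝ ∞ φ)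
    (hc : HasCompactSupport φ) (hsupp : tsupport φ ⊆ Ioi 0) {s : ℝ} (hs0 : 0 ≤ s) :
    ∃ C : ℝ, 0 < C ∧ ∀ h t : ℝ, 0 < h → h ≤ 1 →
      ‖weight n s hs0 ∘L wave n φ hφ.continuous hc t h ∘L weight n s hs0‖ ≤
        C * bracket t ^ (-s) := by
  obtain ⟨M, hM⟩ := hφ.continuous.bounded_above_of_compact_support hc
  have hM0 : 0 ≤ M := (norm_nonneg _).trans (hM 0)
  -- Of these powers of 1 + |t|/h, n absorb the volume of the ball of radius |t|/4 together with
  -- h⁻ⁿ. The other ⌈s⌉ give ⟨t⟩^{-s}, because |t| ≤ |t|/h for h ≤ 1.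
  obtain ⟨C, hC0, hC⟩ := exists_kernel_decay (n := n) hφ hc hsupp (n + ⌈s⌉₊)
  set V := volume.real (ball (0 : Eucl n) 1) with hV
  have hV0 : 0 ≤ V := measureReal_nonneg
  refine ⟨M * 4 ^ s + 4 ^ s * M + C * V + 1, by positivity, fun h t hh hh1 => ?_⟩
  have hb := bracket_pos t
  refine ContinuousLinearMap.opNorm_le_bound _ (by positivity) fun f => ?_
  have hA := measurableSet_ball (x := (0 : Eucl n)) (ε := |t| / 4)
  set W := weight n s hs0
  set T := wave n φ hφ.continuous hc t h
  set z := |t| / h with hz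
  have hz0 : 0 ≤ z := by positivity
  set κ := C * (h ^ n)⁻¹ * ((1 + z) ^ (n + ⌈s⌉₊))⁻¹ with hκ
  have hκ0 : 0 ≤ κ := by positivity
  have hW : ∀ u : LpR n 2, ‖W u‖ ≤ ‖u‖ := norm_weight_le hs0
  have hT : ∀ u : LpR n 2, ‖T u‖ ≤ M * ‖u‖ := norm_wave_le hφ.continuous hc hM t h
  -- A weight next to an exterior cut-off gains ⟨t⟩^{-s}. The interior–interior term sees only ‖x -
  -- y‖ ≤ |t|/2, away from the light cone.
  have e : W (T (W f)) = W (T (cutoff hA.compl (W f))) +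
      (cutoff hA.compl (W (T (cutoff hA (W f)))) + cutoff hA (W (T (cutoff hA (W f))))) := by
    rw [add_comm (cutoff hA.compl _), cutoff_add_cutoff_compl, ← map_add, ← map_add, add_comm,
      cutoff_add_cutoff_compl]
  have b1 : ‖W (T (cutoff hA.compl (W f)))‖ ≤ M * 4 ^ s * bracket t ^ (-s) * ‖f‖ := by
    refine (hW _).trans ((hT _).trans ?_)
    have := norm_cutoff_compl_ball_weight_le hs0 t f
    calc M * ‖cutoff hA.compl (W f)‖ ≤ M * (4 ^ s * bracket t ^ (-s) * ‖f‖) := by gcongr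
      _ = _ := by ring
  have b2 : ‖cutoff hA.compl (W (T (cutoff hA (W f))))‖ ≤
      4 ^ s * M * bracket t ^ (-s) * ‖f‖ := by
    refine (norm_cutoff_compl_ball_weight_le hs0 t _).trans ?_
    have h1 : ‖T (cutoff hA (W f))‖ ≤ M * ‖f‖ := (hT _).trans
      (mul_le_mul_of_nonneg_left ((norm_cutoff_le hA _).trans (hW f)) hM0)
    calc 4 ^ s * bracket t ^ (-s) * ‖T (cutoff hA (W f))‖
        ≤ 4 ^ s * bracket t ^ (-s) * (M * ‖f‖) := by gcongr
      _ = _ := by ring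
  have b3 : ‖cutoff hA (W (T (cutoff hA (W f))))‖ ≤ C * V * bracket t ^ (-s) * ‖f‖ := by
    refine (norm_cutoff_weight_le hA hs0 _).trans ?_
    refine (norm_cutoff_wave_cutoff_le hφ.continuous hc hh hκ0 (fun x hx => hC h t x hh
      (by linarith)) (W f)).trans ?_
    have e1 : volume.real (ball (0 : Eucl n) (|t| / 4)) = (|t| / 4) ^ n * V := by
      rw [measureReal_def, Measure.addHaar_ball _ _ (by positivity), finrank_euclideanSpace_fin,
        ENNReal.toReal_mul, ENNReal.toReal_ofReal (by positivity), hV, measureReal_def]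
    have e2 : κ * ((|t| / 4) ^ n * V) ≤ C * V * bracket t ^ (-s) := by
      have e3 : (|t| / 4) ^ n * (h ^ n)⁻¹ ≤ (1 + z) ^ n := by
        rw [← inv_pow, ← mul_pow]
        refine pow_le_pow_left₀ (by positivity) ?_ n
        have : |t| / 4 * h⁻¹ = z / 4 := by rw [hz]; ring
        linarith
      have e4 : bracket t ^ s ≤ (1 + z) ^ ⌈s⌉₊ := by
        have ht : |t| ≤ z := by
          rw [hz, le_div_iff₀ hh]; nlinarith [abs_nonneg t]
        calc bracket t ^ s ≤ (1 + z) ^ s := Real.rpow_le_rpow hb.le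
              ((bracket_le_one_add_abs t).trans (by linarith)) hs0
          _ ≤ (1 + z) ^ (⌈s⌉₊ : ℝ) := Real.rpow_le_rpow_of_exponent_le (by linarith) (Nat.le_ceil s)
          _ = _ := Real.rpow_natCast _ _
      have e5 : ((1 + z) ^ (n + ⌈s⌉₊))⁻¹ ≤ ((1 + z) ^ n)⁻¹ * bracket t ^ (-s) := by
        rw [pow_add, mul_inv, Real.rpow_neg hb.le]
        gcongr
      calc κ * ((|t| / 4) ^ n * V)
          = C * V * ((|t| / 4) ^ n * (h ^ n)⁻¹) * ((1 + z) ^ (n + ⌈s⌉₊))⁻¹ := by rw [hκ]; ring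
        _ ≤ C * V * (1 + z) ^ n * (((1 + z) ^ n)⁻¹ * bracket t ^ (-s)) := by gcongr
        _ = _ := by field_simp
    rw [e1]
    exact mul_le_mul e2 (hW f) (norm_nonneg _) (by positivity)
  change ‖W (T (W f))‖ ≤ _
  rw [e]
  refine (norm_add_le _ _).trans ((add_le_add b1 ((norm_add_le _ _).trans
    (add_le_add b2 b3))).trans ?_)
  have : 0 ≤ bracket t ^ (-s) * ‖f‖ := by positivity
  nlinarith

end LocalDecay

/-! ### The extension to L¹ → L^∞ -/

section Dispersive

open Metric Set

variable {n : ℕ} {φ : ℝ → ℂ}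

theorem integrable_kernel_mul {k : Eucl n → ℂ} (hk : Continuous k) {κ : ℝ}
    (hκ : ∀ x, ‖k x‖ ≤ κ) (f : LpR n 1) (x : Eucl n) : Integrable fun y => k (x - y) * f y :=
  (L1.integrable_coeFn f).bdd_mul (c := κ)
    (hk.comp (continuous_const.sub continuous_id)).aestronglyMeasurable
    (Filter.Eventually.of_forall fun _ => hκ _)

theorem norm_integral_kernel_mul_le {k : Eucl n → ℂ} {κ : ℝ}
    (hκ : ∀ x, ‖k x‖ ≤ κ) (f : LpR n 1) (x : Eucl n) :
    ‖∫ y, k (x - y) * f y‖ ≤ κ * ‖f‖ := by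
  rw [L1.norm_eq_integral_norm, ← integral_const_mul]
  refine norm_integral_le_of_norm_le ((L1.integrable_coeFn f).norm.const_mul κ)
    (Filter.Eventually.of_forall fun y => ?_)
  rw [norm_mul]
  gcongr
  exact hκ _

theorem memLp_top_integral_kernel_mul {k : Eucl n → ℂ} (hk : Continuous k) {κ : ℝ}
    (hκ : ∀ x, ‖k x‖ ≤ κ) (f : LpR n 1) :
    MemLp (fun x => ∫ y, k (x - y) * f y) ∞ volume := by
  refine memLp_top_of_bound ?_ (κ * ‖f‖)
    (Filter.Eventually.of_forall fun x => norm_integral_kernel_mul_le hκ f x)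
  refine Continuous.aestronglyMeasurable (continuous_of_dominated
    (bound := fun y => κ * ‖f y‖) (fun x => (integrable_kernel_mul hk hκ f x).1) (fun x => ?_)
    ((L1.integrable_coeFn f).norm.const_mul κ) ?_)
  · refine Filter.Eventually.of_forall fun y => ?_
    rw [norm_mul]
    gcongr
    exact hκ _
  · exact Filter.Eventually.of_forall fun _ =>
      (hk.comp (continuous_id.sub continuous_const)).mul continuous_const

/-- Convolution with a bounded continuous kernel, as an operator `L¹ → L^∞`. -/
def convOp (k : Eucl n → ℂ) (hk : Continuous k) (κ : ℝ) (hκ : ∀ x, ‖k x‖ ≤ κ) :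
    LpR n 1 →L[ℂ] LpR n ∞ :=
  LinearMap.mkContinuous
    { toFun := fun f => (memLp_top_integral_kernel_mul hk hκ f).toLp _
      map_add' := fun f g => by
        rw [← MemLp.toLp_add]
        refine MemLp.toLp_congr _ _ (Filter.Eventually.of_forall fun x => ?_)
        simp only [Pi.add_apply]
        rw [← integral_add (integrable_kernel_mul hk hκ f x) (integrable_kernel_mul hk hκ g x)]
        refine integral_congr_ae ?_
        filter_upwards [Lp.coeFn_add f g] with y hy
        rw [hy, Pi.add_apply, mul_add]
      map_smul' := fun c f => by
        rw [RingHom.id_apply, ← MemLp.toLp_const_smul]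
        refine MemLp.toLp_congr _ _ (Filter.Eventually.of_forall fun x => ?_)
        simp only [Pi.smul_apply, smul_eq_mul]
        rw [← integral_const_mul]
        refine integral_congr_ae ?_
        filter_upwards [Lp.coeFn_smul c f] with y hy
        rw [hy, Pi.smul_apply, smul_eq_mul]; ring }
    κ fun f => by
      change ‖(memLp_top_integral_kernel_mul hk hκ f).toLp _‖ ≤ _
      have h0 : 0 ≤ κ * ‖f‖ := mul_nonneg ((norm_nonneg _).trans (hκ 0)) (norm_nonneg _)
      rw [Lp.norm_toLp]
      refine ENNReal.toReal_le_of_le_ofReal h0 ?_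
      rw [eLpNorm_exponent_top]
      exact eLpNormEssSup_le_of_ae_bound
        (Filter.Eventually.of_forall fun x => norm_integral_kernel_mul_le hκ f x)

theorem convOp_ae_eq (k : Eucl n → ℂ) (hk : Continuous k) (κ : ℝ) (hκ : ∀ x, ‖k x‖ ≤ κ)
    (f : LpR n 1) : convOp k hk κ hκ f =ᵐ[volume] fun x => ∫ y, k (x - y) * f y :=
  (memLp_top_integral_kernel_mul hk hκ f).coeFn_toLp

theorem norm_convOp_le (k : Eucl n → ℂ) (hk : Continuous k) (κ : ℝ) (hκ : ∀ x, ‖k x‖ ≤ κ) :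
    ‖convOp k hk κ hκ‖ ≤ κ :=
  LinearMap.mkContinuous_norm_le _ ((norm_nonneg _).trans (hκ 0)) _

/-- The operator does not depend on the bound used to construct it. The extension can thus be built
for every t, including t = 0, from the L¹ norm of the symbol, and be estimated afterwards by the
dispersive bound. -/
theorem convOp_congr_bound (k : Eucl n → ℂ) (hk : Continuous k) (κ κ' : ℝ) (hκ : ∀ x, ‖k x‖ ≤ κ)
    (hκ' : ∀ x, ‖k x‖ ≤ κ') : convOp k hk κ hκ = convOp k hk κ' hκ' := rfl

theorem continuous_kernel_space (hφ : Continuous φ) (hc : HasCompactSupport φ) {h : ℝ}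
    (hh : 0 < h) (t : ℝ) : Continuous (kernel n φ t h) :=
  continuous_fourierInv_of_integrable (integrable_symbol hφ hc hh t)

theorem norm_kernel_le_integral (t h : ℝ) (x : Eucl n) :
    ‖kernel n φ t h x‖ ≤ ∫ ξ : Eucl n, ‖symbol n φ t h ξ‖ := by
  rw [kernel, Real.fourierInv_eq]
  refine (norm_integral_le_integral_norm _).trans_eq ?_
  simp only [Circle.norm_smul]

/-- The extension of `e^{it√G₀} φ(h√G₀)` to an operator `L¹ → L^∞`. -/
def waveL1 (n : ℕ) {φ : ℝ → ℂ} (hφ : Continuous φ) (hc : HasCompactSupport φ) {h : ℝ} (hh : 0 < h)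
    (t : ℝ) : LpR n 1 →L[ℂ] LpR n ∞ :=
  convOp (kernel n φ t h) (continuous_kernel_space hφ hc hh t) _ (norm_kernel_le_integral t h)

theorem isExtension_waveL1 (hφ : Continuous φ) (hc : HasCompactSupport φ) {h : ℝ} (hh : 0 < h)
    (t : ℝ) : IsExtension (wave n φ hφ hc t h) (waveL1 n hφ hc hh t) := by
  intro f h1 h2
  filter_upwards [convOp_ae_eq (kernel n φ t h) (continuous_kernel_space hφ hc hh t) _
    (norm_kernel_le_integral t h) (h1.toLp f), wave_ae_eq hφ hc hh t (h2.toLp f)] with x hx1 hx2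
  rw [waveL1, hx1, hx2]
  refine integral_congr_ae ?_
  filter_upwards [h1.coeFn_toLp, h2.coeFn_toLp] with y hy1 hy2
  rw [hy1, hy2]

theorem norm_waveL1_le (hφ : Continuous φ) (hc : HasCompactSupport φ) {h : ℝ} (hh : 0 < h)
    (t : ℝ) {κ : ℝ} (hκ : ∀ x, ‖kernel n φ t h x‖ ≤ κ) : ‖waveL1 n hφ hc hh t‖ ≤ κ := by
  rw [waveL1, convOp_congr_bound _ _ _ κ _ hκ]
  exact norm_convOp_le _ _ _ _

end Dispersive

/-! ### The L² → L^∞ and time-integrated estimates -/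

section WeightedDispersive

open Metric Set

variable {n : ℕ} {φ : ℝ → ℂ}

/-- Hölder with θ = 2s/(n-1) between Plancherel in x, with no weight and no time decay, and the
dispersive bound with the integrable weight ⟨y⟩^{-w/θ}. The time decay is |t|^{-(n-1)θ} = |t|^{-2s}.
-/
theorem exists_lintegral_kernel_bracket_le (hn : 2 ≤ n) (hφ : ContDiff ℝ ∞ φ)
    (hc : HasCompactSupport φ) (hsupp : tsupport φ ⊆ Ioi 0) {s ε : ℝ} (hs0 : 0 ≤ s)
    (hs : s ≤ ((n : ℝ) - 1) / 2) (hε : 0 < ε) :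
    ∃ C : ℝ, 0 < C ∧ ∀ (h t : ℝ) (x : Eucl n), 0 < h → h ≤ 1 → t ≠ 0 →
      ∫⁻ y, ‖kernel n φ t h (x - y)‖ₑ ^ 2 * ENNReal.ofReal (bracket y ^ (-(1 + 2 * s + 2 * ε))) ≤
        ENNReal.ofReal ((C * h ^ (-(((n : ℝ) + 1) / 2)) * |t| ^ (-s)) ^ 2) := by
  have : NeZero n := ⟨by omega⟩
  obtain ⟨C₁, hC₁0, hC₁⟩ := exists_lintegral_space_kernel_le (n := n) hφ.continuous hc
  obtain ⟨C₂, hC₂0, hC₂⟩ := exists_norm_kernel_le (n := n) hφ hc hsupp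
  have hn' : (2 : ℝ) ≤ n := by exact_mod_cast hn
  set w := 1 + 2 * s + 2 * ε with hw
  have hkm : ∀ (h t : ℝ) (x : Eucl n), 0 < h → Measurable fun y => ‖kernel n φ t h (x - y)‖ₑ ^ 2 :=
    fun h t x hh => (((continuous_kernel_space hφ.continuous hc hh t).comp
      (continuous_const.sub continuous_id)).enorm.measurable).pow_const 2
  have hk1 : ∀ (h t : ℝ) (x : Eucl n), 0 < h →
      ∫⁻ y, ‖kernel n φ t h (x - y)‖ₑ ^ 2 ≤ ENNReal.ofReal (C₁ * h ^ (-(n : ℝ))) :=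
    fun h t x hh => by
      rw [lintegral_sub_left_eq_self (fun z => ‖kernel n φ t h z‖ₑ ^ 2) x]
      exact hC₁ h t hh
  have hsq : ∀ (K h t : ℝ), 0 < K → 0 < h → t ≠ 0 →
      K * h ^ (-((n : ℝ) + 1)) * |t| ^ (-(2 * s)) ≤
        ((K + 1) * h ^ (-(((n : ℝ) + 1) / 2)) * |t| ^ (-s)) ^ 2 := fun K h t hK hh ht => by
    have ht0 : 0 < |t| := abs_pos.2 ht
    have e1 : h ^ (-((n : ℝ) + 1)) = (h ^ (-(((n : ℝ) + 1) / 2))) ^ 2 := by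
      rw [← Real.rpow_natCast, ← Real.rpow_mul hh.le]; congr 1; push_cast; ring
    have e2 : |t| ^ (-(2 * s)) = (|t| ^ (-s)) ^ 2 := by
      rw [← Real.rpow_natCast, ← Real.rpow_mul ht0.le]; congr 1; push_cast; ring
    rw [e1, e2, mul_pow, mul_pow]
    gcongr
    nlinarith
  -- At s = 0 the exponent w/θ degenerates; Plancherel alone suffices there.
  rcases hs0.eq_or_lt with rfl | hspos
  · refine ⟨C₁ + 1, by positivity, fun h t x hh hh1 ht => ?_⟩
    calc ∫⁻ y, ‖kernel n φ t h (x - y)‖ₑ ^ 2 * ENNReal.ofReal (bracket y ^ (-w))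
        ≤ ∫⁻ y, ‖kernel n φ t h (x - y)‖ₑ ^ 2 := by
          refine lintegral_mono fun y => mul_le_of_le_one_right' ?_
          rw [← ENNReal.ofReal_one]
          refine ENNReal.ofReal_le_ofReal (Real.rpow_le_one_of_one_le_of_nonpos
            (one_le_bracket y) ?_)
          rw [hw]; linarith
      _ ≤ ENNReal.ofReal (C₁ * h ^ (-(n : ℝ))) := hk1 h t x hh
      _ ≤ _ := by
          refine ENNReal.ofReal_le_ofReal (le_trans ?_ (hsq C₁ h t hC₁0 hh ht))
          rw [mul_zero, neg_zero, Real.rpow_zero, mul_one]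
          gcongr C₁ * ?_
          exact Real.rpow_le_rpow_of_exponent_ge hh hh1 (by linarith)
  · set θ := 2 * s / ((n : ℝ) - 1) with hθ
    have hn1 : 0 < (n : ℝ) - 1 := by linarith
    have hθ0 : 0 < θ := by positivity
    have hθ1 : θ ≤ 1 := by rw [hθ, div_le_one hn1]; linarith
    have hθs : ((n : ℝ) - 1) * θ = 2 * s := by rw [hθ]; field_simp
    -- Indeed nθ = 2s + θ ≤ 2s + 1 < w; this is where ε > 0 is needed.
    have hwθ : (n : ℝ) < w / θ := by
      rw [lt_div_iff₀ hθ0, hw]; nlinarith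
    have hI := integrable_bracket_rpow hwθ
    set I := ∫ y : Eucl n, bracket y ^ (-(w / θ)) with hI'
    have hI0 : 0 ≤ I := integral_nonneg fun y => Real.rpow_nonneg (bracket_pos y).le _
    set K := C₁ ^ (1 - θ) * (C₂ ^ 2 * (I + 1)) ^ θ with hK
    have hK0 : 0 < K := by positivity
    refine ⟨K + 1, by positivity, fun h t x hh hh1 ht => ?_⟩
    have ht0 : 0 < |t| := abs_pos.2 ht
    set B := C₂ * h ^ (-(((n : ℝ) + 1) / 2)) * |t| ^ (-(((n : ℝ) - 1) / 2)) with hB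
    have hbm : Measurable fun y : Eucl n => ENNReal.ofReal (bracket y ^ (-(w / θ))) :=
      (continuous_bracket_rpow _).measurable.ennreal_ofReal
    have hsplit : ∀ y : Eucl n,
        ‖kernel n φ t h (x - y)‖ₑ ^ 2 * ENNReal.ofReal (bracket y ^ (-w)) =
        (‖kernel n φ t h (x - y)‖ₑ ^ 2) ^ (1 - θ) * (‖kernel n φ t h (x - y)‖ₑ ^ 2 *
          ENNReal.ofReal (bracket y ^ (-(w / θ)))) ^ θ := fun y => by
      rw [ENNReal.mul_rpow_of_nonneg _ _ hθ0.le, ← mul_assoc,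
        ← ENNReal.rpow_add_of_nonneg _ _ (by linarith) hθ0.le, sub_add_cancel, ENNReal.rpow_one,
        ENNReal.ofReal_rpow_of_nonneg (Real.rpow_nonneg (bracket_pos y).le _) hθ0.le,
        ← Real.rpow_mul (bracket_pos y).le]
      congr 4
      field_simp
    have hsecond : ∫⁻ y, ‖kernel n φ t h (x - y)‖ₑ ^ 2 *
        ENNReal.ofReal (bracket y ^ (-(w / θ))) ≤ ENNReal.ofReal (B ^ 2 * (I + 1)) := by
      calc ∫⁻ y, ‖kernel n φ t h (x - y)‖ₑ ^ 2 * ENNReal.ofReal (bracket y ^ (-(w / θ)))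
          ≤ ∫⁻ y : Eucl n, ENNReal.ofReal (B ^ 2) * ENNReal.ofReal (bracket y ^ (-(w / θ))) := by
            refine lintegral_mono fun y => mul_le_mul_left ?_ _
            rw [← ofReal_norm, ← ENNReal.ofReal_pow (norm_nonneg _)]
            refine ENNReal.ofReal_le_ofReal (pow_le_pow_left₀ (norm_nonneg _) ?_ 2)
            exact hC₂ h t _ hh ht
        _ = ENNReal.ofReal (B ^ 2 * I) := by
            rw [lintegral_const_mul' _ _ ENNReal.ofReal_ne_top,
              ← ofReal_integral_eq_lintegral_ofReal hI
              (Filter.Eventually.of_forall fun y => Real.rpow_nonneg (bracket_pos y).le _),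
              ← ENNReal.ofReal_mul (by positivity)]
        _ ≤ _ := by
            refine ENNReal.ofReal_le_ofReal ?_
            gcongr
            linarith
    simp only [hsplit]
    refine (ENNReal.lintegral_mul_norm_pow_le (hkm h t x hh).aemeasurable
      ((hkm h t x hh).mul hbm).aemeasurable (by linarith) hθ0.le (by ring)).trans ?_
    refine (mul_le_mul' (ENNReal.rpow_le_rpow (hk1 h t x hh) (by linarith))
      (ENNReal.rpow_le_rpow hsecond hθ0.le)).trans ?_
    rw [ENNReal.ofReal_rpow_of_nonneg (by positivity) (by linarith),
      ENNReal.ofReal_rpow_of_nonneg (by positivity) hθ0.le, ← ENNReal.ofReal_mul (by positivity)]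
    refine ENNReal.ofReal_le_ofReal (le_trans ?_ (hsq K h t hK0 hh ht))
    have e1 : B ^ 2 * (I + 1) = (C₂ ^ 2 * (I + 1)) * h ^ (-((n : ℝ) + 1)) *
        |t| ^ (-((n : ℝ) - 1)) := by
      have e3 : h ^ (-((n : ℝ) + 1)) = (h ^ (-(((n : ℝ) + 1) / 2))) ^ 2 := by
        rw [← Real.rpow_natCast, ← Real.rpow_mul hh.le]; congr 1; push_cast; ring
      have e4 : |t| ^ (-((n : ℝ) - 1)) = (|t| ^ (-(((n : ℝ) - 1) / 2))) ^ 2 := by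
        rw [← Real.rpow_natCast, ← Real.rpow_mul ht0.le]; congr 1; push_cast; ring
      rw [hB, e3, e4]; ring
    rw [e1, Real.mul_rpow (by positivity) (by positivity),
      Real.mul_rpow (by positivity) (by positivity), Real.mul_rpow (by positivity) (by positivity),
      ← Real.rpow_mul hh.le, ← Real.rpow_mul hh.le, ← Real.rpow_mul ht0.le]
    have e5 : -((n : ℝ) - 1) * θ = -(2 * s) := by rw [neg_mul, hθs]
    rw [e5]
    -- The total exponent is -(n + θ) ≥ -(n + 1), and h ≤ 1.
    have e6 : h ^ (-(n : ℝ) * (1 - θ)) * h ^ (-((n : ℝ) + 1) * θ) ≤ h ^ (-((n : ℝ) + 1)) := by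
      rw [← Real.rpow_add hh]
      refine Real.rpow_le_rpow_of_exponent_ge hh hh1 ?_
      nlinarith
    calc C₁ ^ (1 - θ) * h ^ (-(n : ℝ) * (1 - θ)) *
          ((C₂ ^ 2 * (I + 1)) ^ θ * h ^ (-((n : ℝ) + 1) * θ) * |t| ^ (-(2 * s)))
        = K * (h ^ (-(n : ℝ) * (1 - θ)) * h ^ (-((n : ℝ) + 1) * θ)) * |t| ^ (-(2 * s)) := by
          rw [hK]; ring
      _ ≤ _ := by gcongr

/-- Cauchy–Schwarz in y puts f in L² and leaves the square of kernel times weight, with weight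
exponent 2(1/2 + s + ε). -/
theorem exists_eLpNorm_wave_weight_le (hn : 2 ≤ n) (hφ : ContDiff ℝ ∞ φ)
    (hc : HasCompactSupport φ) (hsupp : tsupport φ ⊆ Ioi 0) {s ε : ℝ} (hs0 : 0 ≤ s)
    (hs : s ≤ ((n : ℝ) - 1) / 2) (hε : 0 < ε) (hp : 0 ≤ 1 / 2 + s + ε) :
    ∃ C : ℝ, 0 < C ∧ ∀ h t : ℝ, 0 < h → h ≤ 1 → t ≠ 0 → ∀ f : LpR n 2,
      eLpNorm (wave n φ hφ.continuous hc t h (weight n (1 / 2 + s + ε) hp f)) ⊤ volume ≤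
        ENNReal.ofReal (C * h ^ (-(((n : ℝ) + 1) / 2)) * |t| ^ (-s)) * eLpNorm f 2 volume := by
  obtain ⟨C, hC0, hC⟩ := exists_lintegral_kernel_bracket_le hn hφ hc hsupp hs0 hs hε
  refine ⟨C, hC0, fun h t hh hh1 ht f => ?_⟩
  rw [eLpNorm_exponent_top]
  refine eLpNormEssSup_le_of_ae_enorm_bound ?_
  filter_upwards [wave_ae_eq hφ.continuous hc hh t (weight n (1 / 2 + s + ε) hp f)] with x hx
  rw [hx, ← ENNReal.pow_le_pow_left_iff two_ne_zero, mul_pow, ← ENNReal.ofReal_pow (by positivity),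
    eLpNorm_two_sq]
  have h1 : ‖∫ y, kernel n φ t h (x - y) * weight n (1 / 2 + s + ε) hp f y‖ₑ ≤
      ∫⁻ y, (‖kernel n φ t h (x - y)‖ₑ * ENNReal.ofReal (bracket y ^ (-(1 / 2 + s + ε)))) *
        ‖f y‖ₑ := by
    refine (enorm_integral_le_lintegral_enorm _).trans (le_of_eq (lintegral_congr_ae ?_))
    filter_upwards [mulOp_ae_eq (memLp_weight n hp) f] with y hy
    rw [weight, hy, enorm_mul, enorm_mul, ← mul_assoc, ← ofReal_norm ((_ : ℝ) : ℂ),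
      Complex.norm_real, Real.norm_of_nonneg (Real.rpow_nonneg (bracket_pos y).le _)]
  refine (pow_le_pow_left' h1 2).trans ((sq_lintegral_mul_le ?_ ?_).trans ?_)
  · exact ((((continuous_kernel_space hφ.continuous hc hh t).comp
      (continuous_const.sub continuous_id)).enorm.measurable).mul
      (continuous_bracket_rpow _).measurable.ennreal_ofReal).aemeasurable
  · exact (Lp.aestronglyMeasurable f).enorm
  · refine mul_le_mul_left (le_trans (le_of_eq ?_) (hC h t x hh hh1 ht)) _
    refine lintegral_congr fun y => ?_
    rw [mul_pow, ← ENNReal.ofReal_pow (Real.rpow_nonneg (bracket_pos y).le _),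
      ← Real.rpow_natCast, ← Real.rpow_mul (bracket_pos y).le]
    congr 3
    push_cast; ring

theorem exists_lintegral_waveL1_le [NeZero n] (hφ : ContDiff ℝ ∞ φ)
    (hc : HasCompactSupport φ) (hsupp : tsupport φ ⊆ Ioi 0) {s ε : ℝ} (hs0 : 0 ≤ s)
    (hs : s ≤ ((n : ℝ) - 1) / 2) (hε : 0 < ε) :
    ∃ C : ℝ, 0 < C ∧ ∀ (h : ℝ) (hh : 0 < h) (f : LpR n 1),
      ∫⁻ t : ℝ, ENNReal.ofReal (|t| ^ (2 * s)) *
        eLpNorm (fun x => ((bracket x ^ (-(1 / 2 + s + ε)) : ℝ) : ℂ) *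
          waveL1 n hφ.continuous hc hh t f x) 2 volume ^ 2 ≤
        ENNReal.ofReal (C * h ^ (-(n : ℝ))) * eLpNorm f 1 volume ^ 2 := by
  have hn : 1 ≤ n := Nat.one_le_iff_ne_zero.2 (NeZero.ne n)
  obtain ⟨C₁, hC₁0, hC₁⟩ := exists_lintegral_weighted_time_kernel_le (n := n) hφ hc hsupp hs0 hs
  -- The exponents satisfy w - q = n + 2ε > n, and the upper bound on s is exactly q ≤ 0.
  obtain ⟨C₂, hC₂0, hC₂⟩ := exists_lintegral_bracket_mul_norm_rpow_le (n := n) hn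
    (w := 1 + 2 * s + 2 * ε) (q := 2 * s - ((n : ℝ) - 1)) (by linarith)
    (by linarith) (by linarith)
  refine ⟨C₁ * C₂, by positivity, fun h hh f => ?_⟩
  set w := 1 + 2 * s + 2 * ε with hw
  set N : ℝ≥0∞ := ∫⁻ y, ‖f y‖ₑ with hN
  have hfN : eLpNorm f 1 volume = N := eLpNorm_one_eq_lintegral_enorm
  have hfm : Measurable fun y => ‖f y‖ₑ := (Lp.stronglyMeasurable f).enorm
  have hkc := continuous_kernel (n := n) hφ.continuous hc hh
  have hbm : Measurable fun x : Eucl n => ENNReal.ofReal (bracket x ^ (-w)) :=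
    (continuous_bracket_rpow _).measurable.ennreal_ofReal
  set H : ℝ → Eucl n → Eucl n → ℝ≥0∞ := fun t x y =>
    ENNReal.ofReal (|t| ^ (2 * s)) * ENNReal.ofReal (bracket x ^ (-w)) *
      ‖kernel n φ t h (x - y)‖ₑ ^ 2 * ‖f y‖ₑ with hH
  clear_value H
  have hHm : Measurable fun p : ℝ × Eucl n × Eucl n => H p.1 p.2.1 p.2.2 := by
    have hk : Measurable fun p : ℝ × Eucl n × Eucl n => ‖kernel n φ p.1 h (p.2.1 - p.2.2)‖ₑ ^ 2 :=
      ((hkc.comp (continuous_fst.prodMk (continuous_snd.fst.sub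
        continuous_snd.snd))).enorm.measurable).pow_const 2
    have ht : Measurable fun p : ℝ × Eucl n × Eucl n => ENNReal.ofReal (|p.1| ^ (2 * s)) := by
      fun_prop
    simp only [hH]
    exact ((ht.mul (hbm.comp measurable_snd.fst)).mul hk).mul (hfm.comp measurable_snd.snd)
  have hpt : ∀ t : ℝ, ENNReal.ofReal (|t| ^ (2 * s)) *
      eLpNorm (fun x => ((bracket x ^ (-(1 / 2 + s + ε)) : ℝ) : ℂ) *
        waveL1 n hφ.continuous hc hh t f x) 2 volume ^ 2 ≤
      (∫⁻ x, ∫⁻ y, H t x y) * N := fun t => by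
    have hkt := continuous_kernel_space (n := n) hφ.continuous hc hh t
    rw [eLpNorm_two_sq, ← lintegral_const_mul' _ _ ENNReal.ofReal_ne_top]
    rw [← lintegral_mul_const _ (Measurable.lintegral_prod_right'
      (f := fun p : Eucl n × Eucl n => H t p.1 p.2) (hHm.comp
        (by fun_prop : Measurable fun p : Eucl n × Eucl n => (t, p.1, p.2))))]
    refine lintegral_mono_ae ?_
    filter_upwards [convOp_ae_eq (kernel n φ t h) hkt _ (norm_kernel_le_integral t h) f] with x hx
    rw [waveL1, hx, enorm_mul, mul_pow]
    have h1 : ‖∫ y, kernel n φ t h (x - y) * f y‖ₑ ^ 2 ≤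
        (∫⁻ y, ‖kernel n φ t h (x - y)‖ₑ ^ 2 * ‖f y‖ₑ) * N := by
      have hkm : Measurable fun y => ‖kernel n φ t h (x - y)‖ₑ :=
        (hkt.comp (continuous_const.sub continuous_id)).enorm.measurable
      have hsq : ∀ a : ℝ≥0∞, (a ^ (1 / 2 : ℝ)) ^ 2 = a := fun a => by
        rw [← ENNReal.rpow_mul_natCast]; norm_num
      -- Writing |K f| as (|K||f|^{1/2})|f|^{1/2} makes Cauchy–Schwarz cost one factor ‖f‖₁ and
      -- leaves |K|² integrated against |f|.
      have h2 : ‖∫ y, kernel n φ t h (x - y) * f y‖ₑ ≤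
          ∫⁻ y, (‖kernel n φ t h (x - y)‖ₑ * ‖f y‖ₑ ^ (1 / 2 : ℝ)) * ‖f y‖ₑ ^ (1 / 2 : ℝ) := by
        refine (enorm_integral_le_lintegral_enorm _).trans (le_of_eq (lintegral_congr fun y => ?_))
        rw [enorm_mul, mul_assoc, ← sq, hsq]
      refine (pow_le_pow_left' h2 2).trans ((sq_lintegral_mul_le
        (hkm.mul (hfm.pow_const _)).aemeasurable (hfm.pow_const _).aemeasurable).trans
        (le_of_eq ?_))
      simp only [Pi.mul_apply, mul_pow, hsq, hN]
    have h3 : ‖((bracket x ^ (-(1 / 2 + s + ε)) : ℝ) : ℂ)‖ₑ ^ 2 =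
        ENNReal.ofReal (bracket x ^ (-w)) := by
      rw [← ofReal_norm, Complex.norm_real,
        Real.norm_of_nonneg (Real.rpow_nonneg (bracket_pos x).le _),
        ← ENNReal.ofReal_pow (Real.rpow_nonneg (bracket_pos x).le _),
        ← Real.rpow_natCast, ← Real.rpow_mul (bracket_pos x).le, hw]
      congr 2; push_cast; ring
    rw [h3, ← mul_assoc]
    have h4 : ∫⁻ y, H t x y = ENNReal.ofReal (|t| ^ (2 * s)) * ENNReal.ofReal (bracket x ^ (-w)) *
        ∫⁻ y, ‖kernel n φ t h (x - y)‖ₑ ^ 2 * ‖f y‖ₑ := by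
      rw [← lintegral_const_mul' _ _
        (ENNReal.mul_ne_top ENNReal.ofReal_ne_top ENNReal.ofReal_ne_top)]
      exact lintegral_congr fun y => by simp only [hH]; ring
    rw [h4, mul_assoc _ _ N]
    exact mul_le_mul_right h1 _
  -- Time must be integrated first, at fixed x - y, since the kernel bound comes from Plancherel in
  -- t; the x-integral is then uniform in y.
  have hswap : ∫⁻ t, ∫⁻ x, ∫⁻ y, H t x y = ∫⁻ y, ∫⁻ x, ∫⁻ t, H t x y := by
    calc ∫⁻ t, ∫⁻ x, ∫⁻ y, H t x y = ∫⁻ t, ∫⁻ y, ∫⁻ x, H t x y :=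
          lintegral_congr fun t => lintegral_lintegral_swap
            (hHm.comp (by fun_prop : Measurable fun p : Eucl n × Eucl n =>
              (t, p.1, p.2))).aemeasurable
      _ = ∫⁻ y, ∫⁻ t, ∫⁻ x, H t x y := by
          refine lintegral_lintegral_swap (Measurable.aemeasurable ?_)
          exact Measurable.lintegral_prod_right' (f := fun p : (ℝ × Eucl n) × Eucl n =>
            H p.1.1 p.2 p.1.2) (hHm.comp (by fun_prop : Measurable fun p : (ℝ × Eucl n) × Eucl n =>
              (p.1.1, p.2, p.1.2)))
      _ = ∫⁻ y, ∫⁻ x, ∫⁻ t, H t x y :=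
          lintegral_congr fun y => lintegral_lintegral_swap
            (hHm.comp (by fun_prop : Measurable fun p : ℝ × Eucl n =>
              (p.1, p.2, y))).aemeasurable
  have hin : ∀ y, ∫⁻ x, ∫⁻ t, H t x y ≤ ENNReal.ofReal (C₁ * C₂ * h ^ (-(n : ℝ))) * ‖f y‖ₑ :=
    fun y => by
    have hne : ‖f y‖ₑ ≠ ⊤ := enorm_ne_top
    have h1 : ∀ᵐ x : Eucl n, ∫⁻ t, H t x y ≤ (ENNReal.ofReal (C₁ * h ^ (-(n : ℝ))) * ‖f y‖ₑ) *
        (ENNReal.ofReal (bracket x ^ (-w)) *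
          ENNReal.ofReal (‖x - y‖ ^ (2 * s - ((n : ℝ) - 1)))) := by
      have : ∀ᵐ x : Eucl n, x ≠ y := by simp [ae_iff]
      filter_upwards [this] with x hxy
      have e1 : ∫⁻ t, H t x y = (ENNReal.ofReal (bracket x ^ (-w)) * ‖f y‖ₑ) *
          ∫⁻ t, ENNReal.ofReal (|t| ^ (2 * s)) * ‖kernel n φ t h (x - y)‖ₑ ^ 2 := by
        rw [← lintegral_const_mul' _ _ (ENNReal.mul_ne_top ENNReal.ofReal_ne_top hne)]
        exact lintegral_congr fun t => by simp only [hH]; ring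
      rw [e1]
      refine (mul_le_mul_right (hC₁ h (x - y) hh (sub_ne_zero.2 hxy)) _).trans (le_of_eq ?_)
      rw [ENNReal.ofReal_mul (by positivity)]
      ring
    refine (lintegral_mono_ae h1).trans ?_
    rw [lintegral_const_mul' _ _ (ENNReal.mul_ne_top ENNReal.ofReal_ne_top hne)]
    refine (mul_le_mul_right (hC₂ y) _).trans (le_of_eq ?_)
    rw [mul_assoc, mul_comm ‖f y‖ₑ, ← mul_assoc, ← ENNReal.ofReal_mul (by positivity)]
    congr 2; ring
  calc _ ≤ ∫⁻ t, (∫⁻ x, ∫⁻ y, H t x y) * N := lintegral_mono hpt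
    _ = (∫⁻ t, ∫⁻ x, ∫⁻ y, H t x y) * N := by
        refine lintegral_mul_const _ ?_
        refine Measurable.lintegral_prod_right' (f := fun p : ℝ × Eucl n => ∫⁻ y, H p.1 p.2 y) ?_
        exact Measurable.lintegral_prod_right' (f := fun p : (ℝ × Eucl n) × Eucl n =>
          H p.1.1 p.1.2 p.2) (hHm.comp (by fun_prop : Measurable
            fun p : (ℝ × Eucl n) × Eucl n => (p.1.1, p.1.2, p.2)))
    _ ≤ (∫⁻ y, ENNReal.ofReal (C₁ * C₂ * h ^ (-(n : ℝ))) * ‖f y‖ₑ) * N := by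
        rw [hswap]
        exact mul_le_mul_left (lintegral_mono hin) _
    _ = _ := by
        rw [lintegral_const_mul' _ _ ENNReal.ofReal_ne_top, hfN, sq, mul_assoc]

end WeightedDispersive

end FreeWave

end

/-! ### The four estimates with one constant -/

theorem proposition2p1 (n : ℕ) (hn : 2 ≤ n) (φ : ℝ → ℂ) (hφ : ContDiff ℝ ∞ φ)
    (hc : HasCompactSupport φ) (hsupp : tsupport φ ⊆ Set.Ioi 0)
    (s : ℝ) (hs0 : 0 ≤ s) (hs : s ≤ ((n : ℝ) - 1) / 2) (ε : ℝ) (hε : 0 < ε) :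
    ∃ C : ℝ, 0 < C ∧ ∀ h : ℝ, 0 < h → h ≤ 1 →
      (∀ t : ℝ,
        ‖FreeWave.weight n s hs0 ∘L FreeWave.wave n φ hφ.continuous hc t h ∘L
          FreeWave.weight n s hs0‖ ≤ C * FreeWave.bracket t ^ (-s)) ∧
      (∀ t : ℝ, t ≠ 0 → ∀ f : FreeWave.LpR n 2,
        eLpNorm (FreeWave.wave n φ hφ.continuous hc t h
            (FreeWave.weight n (1 / 2 + s + ε) (by positivity) f)) ∞ volume
          ≤ ENNReal.ofReal (C * h ^ (-((n : ℝ) + 1) / 2) * |t| ^ (-s)) * eLpNorm f 2 volume) ∧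
      ∃ U : ℝ → FreeWave.LpR n 1 →L[ℂ] FreeWave.LpR n ∞,
        (∀ t : ℝ, FreeWave.IsExtension (FreeWave.wave n φ hφ.continuous hc t h) (U t)) ∧
        (∀ t : ℝ, t ≠ 0 →
          ‖U t‖ ≤ C * h ^ (-((n : ℝ) + 1) / 2) * |t| ^ (-((n : ℝ) - 1) / 2)) ∧
        (∀ f : FreeWave.LpR n 1,
          ∫⁻ t : ℝ, ENNReal.ofReal (|t| ^ (2 * s)) *
            eLpNorm (fun x => ((FreeWave.bracket x ^ (-(1 / 2 + s + ε)) : ℝ) : ℂ) * U t f x)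
              2 volume ^ 2
            ≤ ENNReal.ofReal (C * h ^ (-(n : ℝ))) * eLpNorm f 1 volume ^ 2) := by
  have : NeZero n := ⟨by omega⟩
  have hp : 0 ≤ 1 / 2 + s + ε := by positivity
  obtain ⟨C₁, hC₁0, hC₁⟩ := FreeWave.exists_norm_weight_wave_weight_le (n := n) hφ hc hsupp hs0
  obtain ⟨C₂, hC₂0, hC₂⟩ := FreeWave.exists_norm_kernel_le (n := n) hφ hc hsupp
  obtain ⟨C₃, hC₃0, hC₃⟩ := FreeWave.exists_eLpNorm_wave_weight_le hn hφ hc hsupp hs0 hs hε hp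
  obtain ⟨C₄, hC₄0, hC₄⟩ := FreeWave.exists_lintegral_waveL1_le (n := n) hφ hc hsupp hs0 hs hε
  -- Each bound is increasing in its constant, so the sum serves all four. The same extension
  -- `waveL1` is used in both L¹ statements.
  refine ⟨C₁ + C₂ + C₃ + C₄, by positivity, fun h hh hh1 => ⟨fun t => ?_, fun t ht f => ?_,
    FreeWave.waveL1 n hφ.continuous hc hh,
    FreeWave.isExtension_waveL1 hφ.continuous hc hh, fun t ht => ?_, fun f => ?_⟩⟩
  · refine (hC₁ h t hh hh1).trans ?_
    have := FreeWave.bracket_pos t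
    gcongr
    linarith
  · refine (hC₃ h t hh hh1 ht f).trans ?_
    rw [neg_div]
    gcongr
    linarith
  · refine (FreeWave.norm_waveL1_le hφ.continuous hc hh t fun x => hC₂ h t x hh ht).trans ?_
    rw [neg_div, neg_div]
    gcongr
    linarith
  · refine (hC₄ h hh f).trans ?_
    gcongr
    linarith
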